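/- **Notation.** Let $d\ge 1$, $|v|=\sum_j|v_j|$ on $\mathbb R^d$, $\mathbb S^{d-1}_+=\{u\in\mathbb R^d_+: u_1+\dots+u_d=1\}$, $B^r_+(0,1)=\{x\in\mathbb R^r_+: x_1+\dots+x_r\le 1\}$, and let $\pi(v)$ be the Euclidean projection of $v\in\mathbb R^d_+$ onto $\mathbb S^{d-1}_+$. For $\beta\subset\{1,\dots,d\}$ write $x_\beta=(x_j)_{j\in\beta}$ and $\beta^c$ for the complement; $\mathcal P_d^*$ is the set of nonempty subsets of $\{1,\dots,d\}$. Let $X$ be a random vector in $\mathbb R^d_+$ and $\alpha>0$. * $X\in \mathrm{RV}(\alpha,\Theta)$ ($X$ is regularly varying), $\Theta$ a random vector in $\mathbb S^{d-1}_+$, means that, as $t\to\infty$, $\mathbb P((|X|/t,X/|X|)\in\cdot\mid |X|>t)$ converges weakly to the law of $(Y,\Theta)$, with $Y$ Pareto($\alpha$)-distributed ($\mathbb P(Y>y)=y^{-\alpha}$ for $y\ge1$) and independent of $\Theta$. * $X$ is sparsely regularly varying if there are a random vector $Z$ in $\mathbb S^{d-1}_+$ and a nondegenerate random variable $Y$ such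 that, as $t\to\infty$, $\mathbb P((|X|/t,\pi(X/t))\in\cdot\mid |X|>t)$ converges weakly to the law of $(Y,Z)$. We write $X\in\mathrm{SRV}(\alpha,Z)$ if moreover $Y$ is Pareto($\alpha$)-distributed. For $x\in B^d_+(0,1)$ let $A_x=\{u\in\mathbb S^{d-1}_+: u\ge x\}$. For $\beta\in\mathcal P_d^*$ let $\mathcal X_\beta=\{x\in B^d_+(0,1): x_\beta>0,\ x_{\beta^c}=0\}$, $\mathcal X^0_\beta=\{x\in B^d_+(0,1): x_{\beta^c}=0\}$, and let $\lambda_\beta$ be the ($|\beta|$-dimensional) Lebesgue measure on $\mathcal X_\beta$. For a random vector $Z$ in $\mathbb S^{d-1}_+$ and $\beta\subset\gamma$ in $\mathcal P_d^*$ let $$G_\beta(x)=\mathbb P(Z_\beta>x_\beta,\ Z_{\beta^c}\le x_{\beta^c}),$$ $$H_{\beta,\gamma}(u,v,w)=\mathbb P\Big(\phi_\gamma(Z)_\beta\ge u,\ \min_{j\in\gamma\setminus\beta}\phi_\gamma(Z)_j>v,\ \max_{j\in\gamma^c}\phi_\gamma(Z)_j\le w\Big),\quad u\in B^{|\beta|}_+(0,1),\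 v,w\in[0,1],$$ where $\phi_\gamma(u)_j=u_j+|u_{\gamma^c}|/|\gamma|$ for $j\in\gamma$ and $\phi_\gamma(u)_j=u_j+|u_{\gamma^c\setminus\{j\}}|/(|\gamma|+1)$ for $j\in\gamma^c$; conditions on a minimum or maximum over an empty set are void. Differentiability of $H_{\beta,\gamma}$ is meant on its domain $B^{|\beta|}_+(0,1)\times[0,1]^2$ (so it is one-sided in $v$ and $w$ at $0$), and continuous differentiability at a point means differentiability at all points of the domain near it, with a differential continuous at that point. **Assumption (A)** (on $Z$): for all $\beta\subset\gamma$ in $\mathcal P_d^*$ and $\lambda_\beta$-almost every $x\in\mathcal X_\beta$, the function $H_{\beta,\gamma}$ is continuously differentiable at $(x_\beta,0,0)$. **Theorem (Equivalence of regular variation and sparse regular variation).** Under assumption (A) regular variation and sparse regular variation are equivalent: $X\in\mathrm{RV}(\alpha,\Theta)$ for some $\alpha>0$ and some $\Theta$ for which $\pi(Y\Theta)$ satisfies (A), where $Y$ is Pareto($\alpha$) and independent of $\Theta$, if and only if $X$ is sparsely regularly varying with a limit $(Y,Z)$ for which $Z$ satisfies (A). More precisely: 1. If $X\in\mathrm{RV}(\alpha,\Theta)$,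 then $X\in\mathrm{SRV}(\alpha,Z)$ with $Z=\pi(Y\Theta)$, where $Y$ is Pareto($\alpha$) and independent of $\Theta$, and for all $\beta\in\mathcal P_d^*$ and all $x\in\mathcal X^0_\beta$ with $x_j\ne 1/|\beta|$ for every $j\in\beta$, $$G_\beta(x)=\mathbb E\bigg[\bigg(1\wedge\min_{j\in\beta_+}\Big(\frac{|\beta|\Theta_j-|\Theta_\beta|}{|\beta|x_j-1}\Big)_+^\alpha\wedge\min_{j\in\beta^c}(|\Theta_\beta|-|\beta|\Theta_j)_+^\alpha-\max_{j\in\beta_-}\Big(\frac{|\beta|\Theta_j-|\Theta_\beta|}{|\beta|x_j-1}\Big)_+^\alpha\bigg)_+\bigg],$$ where $\beta_+=\{j\in\beta: x_j>1/|\beta|\}$ and $\beta_-=\{j\in\beta: x_j<1/|\beta|\}$ (a minimum over the empty set is omitted, a maximum over the empty set is $0$). 2. If $X\in\mathrm{SRV}(\alpha,Z)$ with $Z$ satisfying (A), then $X\in\mathrm{RV}(\alpha,\Theta)$ for a random vector $\Theta$ such that, for all $\beta\in\mathcal P_d^*$ and $\lambda_\beta$-almost every $x\in\mathcal X_\beta$,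 $$\mathbb P(\Theta\in A_x)=\mathbb P(Z\in A_x)+\alpha^{-1}\sum_{\gamma\supset\beta}\mathrm dH_{\beta,\gamma}(x_\beta,0,0)\cdot\Big(x_\beta-\frac1{|\gamma|},-\frac1{|\gamma|},-\frac1{|\gamma|+1}\Big),$$ the sum running over all $\gamma\supset\beta$, including $\gamma=\beta$. -/

import Mathlib

open MeasureTheory Filter Topology

noncomputable section

namespace SparseRV

/-! ### Simplex and Euclidean projection onto it -/

/-- The `ℓ¹`-norm on `ℝ^d`. -/
def l1 {d : ℕ} (v : Fin d → ℝ) : ℝ := ∑ j, |v j|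

/-- The positive unit sphere of the `ℓ¹`-norm (the unit simplex). -/
def simplex (d : ℕ) : Set (Fin d → ℝ) := {u | (∀ j, 0 ≤ u j) ∧ ∑ j, u j = 1}

/-- `w` is a point of the simplex at minimal Euclidean distance from `v`. -/
def IsNearest {d : ℕ} (v w : Fin d → ℝ) : Prop :=
  w ∈ simplex d ∧ ∀ w' ∈ simplex d, ∑ j, (w j - v j) ^ 2 ≤ ∑ j, (w' j - v j) ^ 2

/-- The Euclidean projection `π` onto the simplex: the unique nearest point
(see `isNearest_proj` and `IsNearest.eq_proj`). -/
def proj {d : ℕ} (v : Fin d → ℝ) : Fin d → ℝ := Classical.epsilon (IsNearest v)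

theorem isNearest_proj {d : ℕ} (hd : d ≠ 0) (v : Fin d → ℝ) : IsNearest v (proj v) := by
  have hs : simplex d = stdSimplex ℝ (Fin d) := rfl
  have hc : IsCompact (simplex d) := hs ▸ isCompact_stdSimplex ℝ (Fin d)
  have hne : (simplex d).Nonempty := by
    refine ⟨Pi.single ⟨0, Nat.pos_of_ne_zero hd⟩ 1, ?_⟩
    rw [hs]
    exact single_mem_stdSimplex ℝ _
  have hcont : ContinuousOn (fun w : Fin d → ℝ => ∑ j, (w j - v j) ^ 2) (simplex d) := by
    fun_prop
  obtain ⟨w, hw, hmin⟩ := hc.exists_isMinOn hne hcont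
  exact Classical.epsilon_spec (p := IsNearest v) ⟨w, hw, fun w' hw' => hmin hw'⟩

theorem IsNearest.eq {d : ℕ} {v w w' : Fin d → ℝ} (h : IsNearest v w) (h' : IsNearest v w') :
    w = w' := by
  have hm : (fun j => (w j + w' j) / 2) ∈ simplex d := by
    refine ⟨fun j => by have := h.1.1 j; have := h'.1.1 j; linarith, ?_⟩
    rw [← Finset.sum_div, Finset.sum_add_distrib, h.1.2, h'.1.2]
    norm_num
  have h1 := h.2 _ hm
  have h2 := h'.2 _ hm
  have key : ∑ j, ((w j + w' j) / 2 - v j) ^ 2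
      = (∑ j, (w j - v j) ^ 2) / 2 + (∑ j, (w' j - v j) ^ 2) / 2
        - (∑ j, (w j - w' j) ^ 2) / 4 := by
    simp only [Finset.sum_div, ← Finset.sum_add_distrib, ← Finset.sum_sub_distrib]
    exact Finset.sum_congr rfl fun j _ => by ring
  have h0 : ∑ j, (w j - w' j) ^ 2 = 0 :=
    le_antisymm (by linarith) (Finset.sum_nonneg fun j _ => sq_nonneg _)
  funext j
  have := (Finset.sum_eq_zero_iff_of_nonneg fun j _ => sq_nonneg (w j - w' j)).1 h0 j
    (Finset.mem_univ j)
  nlinarith [pow_eq_zero_iff (two_ne_zero) |>.1 this]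

theorem IsNearest.eq_proj {d : ℕ} {v w : Fin d → ℝ} (h : IsNearest v w) : w = proj v :=
  h.eq (Classical.epsilon_spec (p := IsNearest v) ⟨w, h⟩)

/-! ### Regular variation and sparse regular variation

Limit random vectors enter only through their distributions: `S` is the law of `Θ`, `ζ` the law
of `Z`, and `ν` the joint law of `(Y, Z)`. -/

/-- Weak convergence, as `t → ∞`, of the conditional law of `F t` given `|X| > t` towards `ν`.
(If `P(|X| > t) = 0`, then the conditional law is the zero measure; hence, for a probability
measure `ν`, the convergence forces `P(|X| > t) > 0` for all `t`.) -/
def CondWeakLimit {Ω E : Type*} [MeasurableSpace Ω] [TopologicalSpace E] [MeasurableSpace E]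
    {d : ℕ} (P : Measure Ω) (X : Ω → Fin d → ℝ) (F : ℝ → Ω → E) (ν : Measure E) : Prop :=
  ∀ f : BoundedContinuousFunction E ℝ,
    Tendsto (fun t : ℝ => ∫ ω, f (F t ω) ∂(ProbabilityTheory.cond P {ω | t < l1 (X ω)}))
      atTop (𝓝 (∫ e, f e ∂ν))

/-- `X ∈ RV(α, Θ)`, where `Θ` has law `S`: given `|X| > t`, the pair `(|X|/t, X/|X|)` converges
weakly to `(Y, Θ)`, with `Y` Pareto(`α`)-distributed and independent of `Θ`. -/
def RV {Ω : Type*} [MeasurableSpace Ω] {d : ℕ} (P : Measure Ω) (X : Ω → Fin d → ℝ)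
    (α : ℝ) (S : Measure (Fin d → ℝ)) : Prop :=
  0 < α ∧ IsProbabilityMeasure S ∧ (∀ᵐ θ ∂S, θ ∈ simplex d) ∧
    CondWeakLimit P X (fun t ω => (l1 (X ω) / t, (l1 (X ω))⁻¹ • X ω))
      ((ProbabilityTheory.paretoMeasure 1 α).prod S)

/-- `X` is sparsely regularly varying, with limit `(Y, Z)` of law `ν`: given `|X| > t`, the pair
`(|X|/t, π(X/t))` converges weakly to `(Y, Z)`, with `Y` nondegenerate and `Z` in the simplex. -/
def IsSparselyRV {Ω : Type*} [MeasurableSpace Ω] {d : ℕ} (P : Measure Ω) (X : Ω → Fin d → ℝ)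
    (ν : Measure (ℝ × (Fin d → ℝ))) : Prop :=
  IsProbabilityMeasure ν ∧ (∀ᵐ p ∂ν, p.2 ∈ simplex d) ∧ (∀ a : ℝ, ν.fst ≠ Measure.dirac a) ∧
    CondWeakLimit P X (fun t ω => (l1 (X ω) / t, proj (t⁻¹ • X ω))) ν

/-- `X ∈ SRV(α, Z)`, where `Z` has law `ζ`: `X` is sparsely regularly varying with a limit
`(Y, Z)` for which `Y` is Pareto(`α`)-distributed. -/
def SRV {Ω : Type*} [MeasurableSpace Ω] {d : ℕ} (P : Measure Ω) (X : Ω → Fin d → ℝ)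
    (α : ℝ) (ζ : Measure (Fin d → ℝ)) : Prop :=
  0 < α ∧ ∃ ν : Measure (ℝ × (Fin d → ℝ)), IsSparselyRV P X ν ∧
    ν.fst = ProbabilityTheory.paretoMeasure 1 α ∧ ν.snd = ζ

/-- The law of `π(YΘ)`, where `Y` is Pareto(`α`), `Θ` has law `S`, and they are independent. -/
def projLaw {d : ℕ} (α : ℝ) (S : Measure (Fin d → ℝ)) : Measure (Fin d → ℝ) :=
  ((ProbabilityTheory.paretoMeasure 1 α).prod S).map (fun p => proj (p.1 • p.2))

/-! ### Sets and functions on the simplex -/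

/-- `A_x`, the points of the simplex that dominate `x`. -/
def A {d : ℕ} (x : Fin d → ℝ) : Set (Fin d → ℝ) := {u | u ∈ simplex d ∧ ∀ j, x j ≤ u j}

/-- The set `𝒳_β` in the coordinates `x_β ∈ ℝ^β`; the Lebesgue measure `λ_β` on `𝒳_β` is the
restriction of the volume of `ℝ^β` to it. -/
def openFace {d : ℕ} (β : Finset (Fin d)) : Set (β → ℝ) :=
  {y | (∀ j, 0 < y j) ∧ ∑ j, y j ≤ 1}

/-- The point of `ℝ^d` with coordinates `y` in `β` and `0` outside `β`. -/
def extend {d : ℕ} (β : Finset (Fin d)) (y : β → ℝ) : Fin d → ℝ :=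
  fun j => if h : j ∈ β then y ⟨j, h⟩ else 0

/-- `𝒳_β^0`. -/
def closedFace {d : ℕ} (β : Finset (Fin d)) : Set (Fin d → ℝ) :=
  {x | (∀ j, 0 ≤ x j) ∧ ∑ j, x j ≤ 1 ∧ ∀ j, j ∉ β → x j = 0}

/-- `G_β(x) = P(Z_β > x_β, Z_{β^c} ≤ x_{β^c})`. -/
def G {d : ℕ} (ζ : Measure (Fin d → ℝ)) (β : Finset (Fin d)) (x : Fin d → ℝ) : ℝ :=
  ζ.real {z | (∀ j ∈ β, x j < z j) ∧ ∀ j, j ∉ β → z j ≤ x j}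

/-- The map `φ_γ`. -/
def phi {d : ℕ} (γ : Finset (Fin d)) (u : Fin d → ℝ) : Fin d → ℝ := fun j =>
  if j ∈ γ then u j + (∑ k ∈ γᶜ, u k) / (γ.card : ℝ)
  else u j + (∑ k ∈ γᶜ.erase j, u k) / ((γ.card : ℝ) + 1)

/-- `H_{β,γ}(u, v, w) = P(φ_γ(Z)_β ≥ u, min_{γ∖β} φ_γ(Z)_j > v, max_{γ^c} φ_γ(Z)_j ≤ w)`;
conditions on a minimum or maximum over the empty set are void. -/
def H {d : ℕ} (ζ : Measure (Fin d → ℝ)) (β γ : Finset (Fin d)) (p : (β → ℝ) × ℝ × ℝ) : ℝ :=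
  ζ.real {z | (∀ j : β, p.1 j ≤ phi γ z j) ∧ (∀ j ∈ γ \ β, p.2.1 < phi γ z j) ∧
    ∀ j ∈ γᶜ, phi γ z j ≤ p.2.2}

/-- The domain `B_+^{|β|}(0,1) × [0,1] × [0,1]` of `H_{β,γ}`. -/
def domH {d : ℕ} (β : Finset (Fin d)) : Set ((β → ℝ) × ℝ × ℝ) :=
  {y | (∀ j, 0 ≤ y j) ∧ ∑ j, y j ≤ 1} ×ˢ (Set.Icc 0 1 ×ˢ Set.Icc 0 1)

/-- `f`, a function on `D`, is continuously differentiable at `p`: it is differentiable at the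
points of `D` near `p`, and its differential is continuous at `p`. -/
def ContDiffAtIn {E : Type*} [NormedAddCommGroup E] [NormedSpace ℝ E] (f : E → ℝ) (D : Set E)
    (p : E) : Prop :=
  (∀ᶠ q in 𝓝[D] p, DifferentiableWithinAt ℝ f D q) ∧ ContinuousWithinAt (fderivWithin ℝ f D) D p

/-- Assumption (A) on the law `ζ` of `Z`. -/
def AssumptionA {d : ℕ} (ζ : Measure (Fin d → ℝ)) : Prop :=
  ∀ β γ : Finset (Fin d), β.Nonempty → β ⊆ γ →
    ∀ᵐ y ∂(volume.restrict (openFace β)), ContDiffAtIn (H ζ β γ) (domH β) (y, 0, 0)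

/-- `dH_{β,γ}(y,0,0) · (y - 1/|γ|, -1/|γ|, -1/(|γ|+1))`; the differential is that of a function on
`domH β` (one-sided in the last two variables). -/
def dHterm {d : ℕ} (ζ : Measure (Fin d → ℝ)) (β γ : Finset (Fin d)) (y : β → ℝ) : ℝ :=
  fderivWithin ℝ (H ζ β γ) (domH β) (y, 0, 0)
    (fun j => y j - 1 / (γ.card : ℝ), -(1 / (γ.card : ℝ)), -(1 / ((γ.card : ℝ) + 1)))

/-- `((|β| θ_j - |θ_β|) / (|β| x_j - 1))_+^α`. -/
def ratioTerm {d : ℕ} (α : ℝ) (β : Finset (Fin d)) (x θ : Fin d → ℝ) (j : Fin d) : ℝ :=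
  (max (((β.card : ℝ) * θ j - ∑ k ∈ β, θ k) / ((β.card : ℝ) * x j - 1)) 0) ^ α

/-- `(|θ_β| - |β| θ_j)_+^α`. -/
def gapTerm {d : ℕ} (α : ℝ) (β : Finset (Fin d)) (θ : Fin d → ℝ) (j : Fin d) : ℝ :=
  (max ((∑ k ∈ β, θ k) - (β.card : ℝ) * θ j) 0) ^ α

/-- The random variable in the formula for `G_β(x)`:
`(1 ∧ min_{β₊} ratioTerm ∧ min_{β^c} gapTerm - max_{β₋} ratioTerm)_+`, with
`β₊ = {j ∈ β | x_j > 1/|β|}` and `β₋ = {j ∈ β | x_j < 1/|β|}`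
(a minimum over the empty set is dropped, a maximum over the empty set is `0`). -/
def integrandG {d : ℕ} (α : ℝ) (β : Finset (Fin d)) (x θ : Fin d → ℝ) : ℝ :=
  max (min ((β.filter fun j => 1 / (β.card : ℝ) < x j).fold min 1 (ratioTerm α β x θ))
        (βᶜ.fold min 1 (gapTerm α β θ))
      - (β.filter fun j => x j < 1 / (β.card : ℝ)).fold max 0 (ratioTerm α β x θ)) 0

end SparseRV

end

noncomputable section

namespace SparseRV

open ProbabilityTheory

/-! ### The projection onto the simplex -/

/-! Write `r = |X|/t` and `θ = X/|X|`, so that `π(X/t) = π(rθ)`. Regular variation implies sparse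
regular variation by continuous mapping (`RV.sRV`). For fixed `θ`, the event defining `G_β` for
`π(Yθ)` restricts `U = Y^(-α)` to an interval; since `U` is uniform on `(0,1]`, its probability is a
length, and Fubini gives the formula (`G_projLaw`).

Conversely, a nondegenerate limit of `|X|/t` is Pareto, because ratios of tail probabilities
converge to a multiplicative function (`CondWeakLimit.exists_pareto`). For the angle, `π(rθ)` is
within `2(r-1)` of `θ`. Hence on a thin shell `t < |X| < q²t` the average of a Lipschitz function of
`X/|X|` nearly equals that of `π(X/t)`, which converges. The tail `{|X| > t}` decomposes into the
shells at levels `t qⁿ`, on all of which the average is close to the same constant; summing and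
letting `q ↓ 1` shows that the angular averages converge (`angular_almost_limit`), and compactness
of the simplex supplies a limit law (`exists_angular_limit`). Radius and angle decouple
(`rV_of_angular_limit`), and uniqueness of limits identifies the law of `Z` with that of `π(YΘ)`
(`SRV.exists_rV`).

For the law of `Θ`: since `π(qπ(v)) = π(qv)` for `q ≥ 1`, and `Y` given `Y > q` is distributed as
`qY`, one has `P(Y ≤ q, π(YΘ) ∈ B) = P(Z ∈ B) - q^(-α) P(π(qZ) ∈ B)` (`real_le_proj_mem`). Divide by
`P(Y ≤ q)` and let `q ↓ 1`. The left side tends to `P(Θ ∈ B)` for `B = A_x` and almost every `x`.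
With `q = 1/(1-s)`, sorting by the support `γ` of the projection writes `P(π(qZ) ∈ A_x)` as a sum of
the `H_{β,γ}` along segments starting at `(x_β, 0, 0)`; assumption (A) and the chain rule then give
its derivative at `s = 0` (`real_A_eq`). -/

theorem exists_threshold {d : ℕ} (hd : d ≠ 0) (v : Fin d → ℝ) :
    ∃ κ : ℝ, ∑ j, max (v j - κ) 0 = 1 := by
  have hcont : Continuous fun κ : ℝ => ∑ j, max (v j - κ) 0 := by fun_prop
  have hv : ∀ j, |v j| ≤ ‖v‖ := fun j => norm_le_pi_norm v j
  have h0 : ∑ j, max (v j - ‖v‖) 0 = 0 :=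
    Finset.sum_eq_zero fun j _ => max_eq_right (by linarith [le_abs_self (v j), hv j])
  have h1 : 1 ≤ ∑ j, max (v j - (-‖v‖ - 1)) 0 := by
    have : ∀ j, 1 ≤ max (v j - (-‖v‖ - 1)) 0 := fun j =>
      le_max_of_le_left (by linarith [neg_abs_le (v j), hv j])
    calc (1 : ℝ) ≤ max (v ⟨0, Nat.pos_of_ne_zero hd⟩ - (-‖v‖ - 1)) 0 := this _
      _ ≤ _ := Finset.single_le_sum (f := fun j => max (v j - (-‖v‖ - 1)) 0)
        (fun j _ => le_max_right _ _) (Finset.mem_univ _)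
  obtain ⟨κ, hκ⟩ := mem_range_of_exists_le_of_exists_ge hcont ⟨‖v‖, by simp [h0]⟩ ⟨_, h1⟩
  exact ⟨κ, hκ⟩

/-- Here `κ` is the Lagrange multiplier of the constraint that the coordinates sum to one. The
linear terms in `key` cancel on summation because both points satisfy this constraint. -/
theorem proj_eq_of_threshold {d : ℕ} {v : Fin d → ℝ} {κ : ℝ}
    (h : ∑ j, max (v j - κ) 0 = 1) : proj v = fun j => max (v j - κ) 0 := by
  symm
  apply IsNearest.eq_proj
  refine ⟨⟨fun j => le_max_right _ _, h⟩, fun w hw => ?_⟩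
  have key : ∀ j, (max (v j - κ) 0 - v j) ^ 2 - 2 * κ * (w j - max (v j - κ) 0)
      ≤ (w j - v j) ^ 2 := fun j => by
    have h0 := hw.1 j
    rcases le_total (v j - κ) 0 with h | h
    · rw [max_eq_right h]; nlinarith
    · rw [max_eq_left h]; nlinarith [sq_nonneg (w j - v j + κ)]
  have := Finset.sum_le_sum fun j (_ : j ∈ Finset.univ) => key j
  rw [Finset.sum_sub_distrib, ← Finset.mul_sum, Finset.sum_sub_distrib, hw.2, h] at this
  linarith

theorem exists_proj_eq {d : ℕ} (hd : d ≠ 0) (v : Fin d → ℝ) :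
    ∃ κ : ℝ, ∑ j, max (v j - κ) 0 = 1 ∧ proj v = fun j => max (v j - κ) 0 :=
  (exists_threshold hd v).imp fun _ h => ⟨h, proj_eq_of_threshold h⟩

theorem proj_mem {d : ℕ} (hd : d ≠ 0) (v : Fin d → ℝ) : proj v ∈ simplex d :=
  (isNearest_proj hd v).1

theorem proj_of_mem {d : ℕ} {u : Fin d → ℝ} (hu : u ∈ simplex d) : proj u = u := by
  symm
  apply IsNearest.eq_proj
  refine ⟨hu, fun w _ => ?_⟩
  simpa using Finset.sum_nonneg fun j _ => sq_nonneg (w j - u j)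

theorem ne_zero_of_mem_simplex {d : ℕ} {u : Fin d → ℝ} (hu : u ∈ simplex d) : d ≠ 0 := by
  rintro rfl
  simpa using hu.2

/-- The threshold is monotone in the vector and moves by `ε` when all coordinates do. If `κ'`
exceeded `κ + ε`, every truncated coordinate of `w` would be at most that of `v`, strictly so at a
positive one, and the two sums could not agree. -/
theorem threshold_le {d : ℕ} {v w : Fin d → ℝ} {κ κ' ε : ℝ} (h : ∀ j, w j ≤ v j + ε)
    (hv : ∑ j, max (v j - κ) 0 = 1) (hw : ∑ j, max (w j - κ') 0 = 1) : κ' ≤ κ + ε := by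
  by_contra! hlt
  have hle : ∀ j, max (w j - κ') 0 ≤ max (v j - κ) 0 := fun j =>
    max_le_max_right _ (by linarith [h j])
  obtain ⟨j, hj⟩ : ∃ j, 0 < max (w j - κ') 0 := by
    by_contra! hn
    have := Finset.sum_nonpos fun j (_ : j ∈ Finset.univ) => hn j
    linarith
  have hpos : 0 < w j - κ' := by simpa using hj
  have := Finset.sum_lt_sum (fun j _ => hle j) ⟨j, Finset.mem_univ j, by
    rw [max_eq_left hpos.le]
    exact lt_max_of_lt_left (by linarith [h j])⟩
  linarith

/-- In the sup norm the threshold is 1-Lipschitz, so a coordinate minus the threshold is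
2-Lipschitz. -/
theorem norm_proj_sub_le {d : ℕ} (v w : Fin d → ℝ) : ‖proj v - proj w‖ ≤ 2 * ‖v - w‖ := by
  rcases eq_or_ne d 0 with rfl | hd
  · rw [Subsingleton.elim (proj v) (proj w), sub_self, norm_zero]
    positivity
  obtain ⟨κ, hκ, hp⟩ := exists_proj_eq hd v
  obtain ⟨κ', hκ', hp'⟩ := exists_proj_eq hd w
  have hvw : ∀ j, |v j - w j| ≤ ‖v - w‖ := fun j => norm_le_pi_norm (v - w) j
  have h1 : κ' ≤ κ + ‖v - w‖ :=
    threshold_le (fun j => by linarith [neg_abs_le (v j - w j), hvw j]) hκ hκ'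
  have h2 : κ ≤ κ' + ‖v - w‖ :=
    threshold_le (fun j => by linarith [le_abs_self (v j - w j), hvw j]) hκ' hκ
  refine (pi_norm_le_iff_of_nonneg (by positivity)).2 fun j => ?_
  rw [hp, hp']
  refine (abs_max_sub_max_le_abs _ _ _).trans ?_
  have := abs_le.1 (hvw j)
  rw [abs_le]
  constructor <;> linarith

theorem continuous_proj {d : ℕ} : Continuous (proj (d := d)) :=
  (LipschitzWith.of_dist_le_mul (K := 2) fun v w => by
    simpa [dist_eq_norm] using norm_proj_sub_le v w).continuous

theorem measurable_proj {d : ℕ} : Measurable (proj (d := d)) := continuous_proj.measurable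

/-- Two successive truncations merge into one with threshold `q * κ + κ'` as soon as `κ' ≥ 0`. This
sign comes from `q ≥ 1`: the dilated projection has total mass `q`, and truncation must not increase
it. -/
theorem proj_smul_proj {d : ℕ} {q : ℝ} (hq : 1 ≤ q) (v : Fin d → ℝ) :
    proj (q • proj v) = proj (q • v) := by
  rcases eq_or_ne d 0 with rfl | hd
  · exact Subsingleton.elim _ _
  obtain ⟨κ, hκ, hp⟩ := exists_proj_eq hd v
  obtain ⟨κ', hκ', hp'⟩ := exists_proj_eq hd (q • proj v)
  have h0 : 0 ≤ κ' := by
    by_contra! hneg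
    have hlt : ∑ j, q * proj v j < ∑ j, max ((q • proj v) j - κ') 0 := by
      refine Finset.sum_lt_sum_of_nonempty ⟨⟨0, Nat.pos_of_ne_zero hd⟩, Finset.mem_univ _⟩
        fun j _ => lt_max_of_lt_left ?_
      simp only [Pi.smul_apply, smul_eq_mul]
      linarith
    rw [← Finset.mul_sum, (proj_mem hd v).2, hκ'] at hlt
    linarith
  have key : ∀ j, max ((q • proj v) j - κ') 0 = max ((q • v) j - (q * κ + κ')) 0 := fun j => by
    simp only [Pi.smul_apply, smul_eq_mul, hp]
    rcases le_total (v j - κ) 0 with h | h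
    · rw [max_eq_right h, max_eq_right, max_eq_right] <;> nlinarith
    · rw [max_eq_left h]; congr 1; ring
  rw [hp', proj_eq_of_threshold (v := q • v) (κ := q * κ + κ')]
  · exact funext key
  · rw [← hκ']
    exact Finset.sum_congr rfl fun j _ => (key j).symm

theorem norm_le_one_of_mem {d : ℕ} {u : Fin d → ℝ} (hu : u ∈ simplex d) : ‖u‖ ≤ 1 := by
  refine (pi_norm_le_iff_of_nonneg zero_le_one).2 fun j => ?_
  rw [Real.norm_of_nonneg (hu.1 j), ← hu.2]
  exact Finset.single_le_sum (fun k _ => hu.1 k) (Finset.mem_univ j)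

theorem norm_proj_smul_sub_le {d : ℕ} {u : Fin d → ℝ} (hu : u ∈ simplex d) {r : ℝ}
    (hr : 1 ≤ r) : ‖proj (r • u) - u‖ ≤ 2 * (r - 1) := by
  have h1 := norm_proj_sub_le (r • u) u
  rw [proj_of_mem hu] at h1
  have h2 : r • u - u = (r - 1) • u := by rw [sub_smul, one_smul]
  rw [h2, norm_smul, Real.norm_of_nonneg (by linarith)] at h1
  nlinarith [norm_le_one_of_mem hu]

/-- The value which the projection of `v` has in a coordinate `j` of its support `β`. -/
def faceCoord {d : ℕ} (β : Finset (Fin d)) (v : Fin d → ℝ) (j : Fin d) : ℝ :=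
  v j + (1 - ∑ k ∈ β, v k) / β.card

theorem proj_eq_faceCoord {d : ℕ} {β : Finset (Fin d)} (hβ : β.Nonempty) {v : Fin d → ℝ}
    (h1 : ∀ j ∈ β, 0 ≤ faceCoord β v j) (h2 : ∀ j, j ∉ β → faceCoord β v j ≤ 0) :
    proj v = fun j => max (faceCoord β v j) 0 := by
  have hc : (β.card : ℝ) ≠ 0 := by exact_mod_cast hβ.card_ne_zero
  have hf : ∀ j, v j - (-((1 - ∑ k ∈ β, v k) / β.card)) = faceCoord β v j := fun j => by
    rw [faceCoord]; ring
  have hs : ∑ j, max (faceCoord β v j) 0 = 1 := by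
    rw [← Finset.sum_subset (Finset.subset_univ β) fun j _ hj => max_eq_right (h2 j hj)]
    calc ∑ j ∈ β, max (faceCoord β v j) 0 = ∑ j ∈ β, (v j + (1 - ∑ k ∈ β, v k) / β.card) :=
          Finset.sum_congr rfl fun j hj => max_eq_left (h1 j hj)
      _ = 1 := by
        rw [Finset.sum_add_distrib, Finset.sum_const, nsmul_eq_mul]
        field_simp
        ring
  simp only [← hf] at hs ⊢
  exact proj_eq_of_threshold hs

/-- The mass on the support equals one, which forces the threshold. The support of the projection is
thus described by linear inequalities in `v`. -/
theorem support_proj_iff {d : ℕ} {β : Finset (Fin d)} (hβ : β.Nonempty) (v : Fin d → ℝ) :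
    ((∀ j ∈ β, 0 < proj v j) ∧ ∀ j, j ∉ β → proj v j = 0) ↔
      (∀ j ∈ β, 0 < faceCoord β v j) ∧ ∀ j, j ∉ β → faceCoord β v j ≤ 0 := by
  have hc : (β.card : ℝ) ≠ 0 := by exact_mod_cast hβ.card_ne_zero
  constructor
  · rintro ⟨h1, h2⟩
    have hd : d ≠ 0 := by
      rintro rfl
      obtain ⟨j, _⟩ := hβ
      exact j.elim0
    obtain ⟨κ, hκ, hp⟩ := exists_proj_eq hd v
    rw [hp] at h1 h2
    have hs : ∑ j ∈ β, (v j - κ) = 1 := by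
      rw [← hκ, ← Finset.sum_subset (Finset.subset_univ β) fun j _ hj => h2 j hj]
      refine Finset.sum_congr rfl fun j hj => ?_
      have := h1 j hj
      rw [max_eq_left]
      by_contra! hlt
      simp only [max_eq_right hlt.le, lt_irrefl] at this
    have hκ' : (1 - ∑ k ∈ β, v k) / β.card = -κ := by
      rw [Finset.sum_sub_distrib, Finset.sum_const, nsmul_eq_mul] at hs
      field_simp
      linarith
    simp only [faceCoord, hκ', ← sub_eq_add_neg]
    refine ⟨fun j hj => ?_, fun j hj => ?_⟩
    · simpa using h1 j hj
    · simpa using h2 j hj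
  · rintro ⟨h1, h2⟩
    rw [proj_eq_faceCoord hβ (fun j hj => (h1 j hj).le) h2]
    exact ⟨fun j hj => lt_max_of_lt_left (h1 j hj), fun j hj => max_eq_right (h2 j hj)⟩

theorem proj_apply_of_support {d : ℕ} {β : Finset (Fin d)} (hβ : β.Nonempty) {v : Fin d → ℝ}
    (h1 : ∀ j ∈ β, 0 < proj v j) (h2 : ∀ j, j ∉ β → proj v j = 0) {j : Fin d} (hj : j ∈ β) :
    proj v j = faceCoord β v j := by
  obtain ⟨h3, h4⟩ := (support_proj_iff hβ v).1 ⟨h1, h2⟩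
  rw [proj_eq_faceCoord hβ (fun j hj => (h3 j hj).le) h4]
  exact max_eq_left (h3 j hj).le

theorem isClosed_simplex {d : ℕ} : IsClosed (simplex d) := isClosed_stdSimplex ℝ (Fin d)

theorem isCompact_simplex {d : ℕ} : IsCompact (simplex d) := isCompact_stdSimplex ℝ (Fin d)

theorem l1_of_nonneg {d : ℕ} {v : Fin d → ℝ} (h : ∀ j, 0 ≤ v j) : l1 v = ∑ j, v j :=
  Finset.sum_congr rfl fun j _ => abs_of_nonneg (h j)

theorem continuous_l1 {d : ℕ} : Continuous (l1 (d := d)) := by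
  unfold l1; fun_prop

theorem inv_l1_smul_mem {d : ℕ} {v : Fin d → ℝ} (h : ∀ j, 0 ≤ v j) (h0 : 0 < l1 v) :
    (l1 v)⁻¹ • v ∈ simplex d := by
  refine ⟨fun j => mul_nonneg (by positivity) (h j), ?_⟩
  simp only [Pi.smul_apply, smul_eq_mul, ← Finset.mul_sum, ← l1_of_nonneg h]
  exact inv_mul_cancel₀ h0.ne'

/-! ### The Pareto distribution -/

instance nullSingletonClass_pareto (α : ℝ) : NullSingletonClass (paretoMeasure 1 α) := by
  unfold paretoMeasure
  exact ⟨fun x => withDensity_absolutelyContinuous _ _ (measure_singleton x)⟩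

theorem measurableSet_forall_mem {E ι : Type*} [MeasurableSpace E] (s : Finset ι)
    {p : ι → E → Prop} (h : ∀ j ∈ s, MeasurableSet {x | p j x}) :
    MeasurableSet {x | ∀ j ∈ s, p j x} := by
  simp only [Set.ofPred_forall]
  exact s.measurableSet_biInter h

theorem pareto_Iio_one (α : ℝ) : paretoMeasure 1 α (Set.Iio 1) = 0 := by
  rw [paretoMeasure, withDensity_apply _ measurableSet_Iio]
  exact lintegral_paretoPDF_of_le le_rfl

theorem ae_pareto_one_le (α : ℝ) : ∀ᵐ r ∂paretoMeasure 1 α, 1 ≤ r := by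
  rw [ae_iff]
  convert pareto_Iio_one α using 2
  ext r; simp

theorem pareto_Ici {α s : ℝ} (hα : 0 < α) (hs : 1 ≤ s) :
    paretoMeasure 1 α (Set.Ici s) = ENNReal.ofReal (s ^ (-α)) := by
  have hs0 : 0 < s := by linarith
  rw [paretoMeasure, withDensity_apply _ measurableSet_Ici,
    setLIntegral_congr Ioi_ae_eq_Ici.symm,
    setLIntegral_congr_fun (g := fun r => ENNReal.ofReal (α * r ^ (-(α + 1)))) measurableSet_Ioi,
    ← ofReal_integral_eq_lintegral_ofReal]
  · rw [integral_const_mul, integral_Ioi_rpow_of_lt (by linarith) hs0]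
    congr 1
    rw [show -(α + 1) + 1 = -α by ring]
    field_simp
  · exact ((integrableOn_Ioi_rpow_of_lt (by linarith) hs0).const_mul α)
  · filter_upwards [ae_restrict_mem measurableSet_Ioi] with r hr
    have : 0 < r := hs0.trans hr
    simp only [Pi.zero_apply]
    positivity
  · intro r hr
    have hr' : s < r := hr
    simp [paretoPDF_of_le (t := 1) (r := α) (x := r) (by linarith)]

theorem pareto_Ici_max {α : ℝ} (hα : 0 < α) (s : ℝ) :
    paretoMeasure 1 α (Set.Ici s) = ENNReal.ofReal (max s 1 ^ (-α)) := by
  rcases le_total 1 s with h | h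
  · rw [pareto_Ici hα h, max_eq_left h]
  · rw [max_eq_right h, ← pareto_Ici hα le_rfl]
    refine measure_congr ?_
    filter_upwards [ae_pareto_one_le α] with r hr
    exact propext ⟨fun _ => hr, fun _ => h.trans hr⟩

theorem pareto_Ioi {α s : ℝ} (hα : 0 < α) (hs : 1 ≤ s) :
    paretoMeasure 1 α (Set.Ioi s) = ENNReal.ofReal (s ^ (-α)) := by
  rw [← pareto_Ici hα hs, measure_congr Ioi_ae_eq_Ici]

theorem pareto_real_Ioi {α s : ℝ} (hα : 0 < α) (hs : 1 ≤ s) :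
    (paretoMeasure 1 α).real (Set.Ioi s) = s ^ (-α) := by
  rw [measureReal_def, pareto_Ioi hα hs,
    ENNReal.toReal_ofReal (Real.rpow_nonneg (by linarith) _)]

/-- Multiplicative lack of memory of the Pareto law, checked on half-lines. -/
theorem pareto_restrict_Ioi {α q : ℝ} (hα : 0 < α) (hq : 1 ≤ q) :
    (paretoMeasure 1 α).restrict (Set.Ioi q) =
      ENNReal.ofReal (q ^ (-α)) • (paretoMeasure 1 α).map (fun r => q * r) := by
  have := isProbabilityMeasure_paretoMeasure zero_lt_one hα
  have hq0 : 0 < q := by linarith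
  refine Measure.ext_of_Ici _ _ fun a => ?_
  rw [Measure.restrict_apply measurableSet_Ici, Measure.smul_apply, smul_eq_mul,
    Measure.map_apply (by fun_prop) measurableSet_Ici]
  have h1 : (fun r => q * r) ⁻¹' Set.Ici a = Set.Ici (a / q) := by
    ext r; simp [div_le_iff₀' hq0]
  rw [h1, pareto_Ici_max hα, ← ENNReal.ofReal_mul (by positivity),
    ← Real.mul_rpow hq0.le (by positivity), mul_max_of_nonneg _ _ hq0.le, mul_one,
    mul_div_cancel₀ _ hq0.ne']
  rcases le_or_gt a q with h | h
  · rw [max_eq_right h, ← pareto_Ioi hα hq]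
    congr 1
    ext r; simp only [Set.mem_inter_iff, Set.mem_Ici, Set.mem_Ioi]
    exact ⟨fun h => h.2, fun h' => ⟨by linarith, h'⟩⟩
  · rw [max_eq_left h.le, ← pareto_Ici hα (by linarith)]
    congr 1
    ext r; simp only [Set.mem_inter_iff, Set.mem_Ici, Set.mem_Ioi]
    exact ⟨fun h => h.1, fun h' => ⟨h', by linarith⟩⟩

/-- The probability integral transform: `Y^(-α)` is uniform, which turns Pareto probabilities into
lengths. -/
theorem pareto_map_rpow {α : ℝ} (hα : 0 < α) :
    (paretoMeasure 1 α).map (fun r => r ^ (-α)) = volume.restrict (Set.Ioc 0 1) := by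
  have := isProbabilityMeasure_paretoMeasure zero_lt_one hα
  have hm : Measurable fun r : ℝ => r ^ (-α) := by fun_prop
  have := Measure.isProbabilityMeasure_map (μ := paretoMeasure 1 α) hm.aemeasurable
  refine Measure.ext_of_Iic _ _ fun u => ?_
  rw [Measure.map_apply hm measurableSet_Iic, Measure.restrict_apply measurableSet_Iic]
  have hpos : ∀ r : ℝ, 1 ≤ r → 0 < r ^ (-α) := fun r hr => Real.rpow_pos_of_pos (by linarith) _
  rcases le_or_gt u 0 with hu | hu
  · have h1 : Set.Iic u ∩ Set.Ioc 0 1 = ∅ := by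
      ext r; simp only [Set.mem_inter_iff, Set.mem_Iic, Set.mem_Ioc, Set.mem_empty_iff_false,
        iff_false]
      rintro ⟨h, h', _⟩; linarith
    rw [h1, measure_empty]
    refine measure_eq_zero_iff_ae_notMem.2 ?_
    filter_upwards [ae_pareto_one_le α] with r hr h
    have h' : r ^ (-α) ≤ u := h
    linarith [hpos r hr]
  · have h1 : Set.Iic u ∩ Set.Ioc 0 1 = Set.Ioc 0 (min u 1) := by
      ext r; simp only [Set.mem_inter_iff, Set.mem_Iic, Set.mem_Ioc, le_min_iff]; tauto
    have hm0 : 0 < min u 1 := lt_min hu one_pos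
    have hle : ∀ r : ℝ, 1 ≤ r → (r ^ (-α) ≤ u ↔ (min u 1) ^ (-α⁻¹) ≤ r) := fun r hr => by
      have h2 : r ^ (-α) ≤ 1 := Real.rpow_le_one_of_one_le_of_nonpos hr (by linarith)
      have h3 : r ^ (-α) ≤ u ↔ r ^ (-α) ≤ min u 1 := by simp [h2]
      rw [h3, ← Real.rpow_le_rpow_iff_of_neg hm0 (hpos r hr) (z := -α⁻¹) (by simpa using hα),
        ← Real.rpow_mul (by linarith)]
      simp [hα.ne']
    have h4 : 1 ≤ (min u 1) ^ (-α⁻¹) :=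
      Real.one_le_rpow_of_pos_of_le_one_of_nonpos hm0 (min_le_right _ _) (by simpa using hα.le)
    have h5 : paretoMeasure 1 α ((fun r => r ^ (-α)) ⁻¹' Set.Iic u) =
        paretoMeasure 1 α (Set.Ici ((min u 1) ^ (-α⁻¹))) := by
      refine measure_congr ?_
      filter_upwards [ae_pareto_one_le α] with r hr
      exact propext (hle r hr)
    rw [h5, pareto_Ici hα h4, h1, Real.volume_Ioc, sub_zero, ← Real.rpow_mul hm0.le]
    simp [hα.ne']

/-! ### The formula for `G_β` -/

/-- This and the next two lemmas translate bounds on `u = r^(-α)` into linear inequalities in `r`.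
The sign of the denominator `B` decides whether the bound is from above or below. -/
theorem rpow_neg_lt_iff {α r B A : ℝ} (hα : 0 < α) (hr : 0 < r) (hB : 0 < B) :
    r ^ (-α) < (max (A / B) 0) ^ α ↔ B < r * A := by
  rw [Real.rpow_neg hr.le, ← Real.inv_rpow hr.le,
    Real.rpow_lt_rpow_iff (by positivity) (le_max_right _ _) hα, lt_max_iff,
    or_iff_left (by have := inv_pos.2 hr; linarith), lt_div_iff₀ hB, inv_mul_lt_iff₀ hr]

theorem lt_rpow_neg_iff {α r B A : ℝ} (hα : 0 < α) (hr : 0 < r) (hB : B < 0) :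
    (max (A / B) 0) ^ α < r ^ (-α) ↔ B < r * A := by
  rw [Real.rpow_neg hr.le, ← Real.inv_rpow hr.le,
    Real.rpow_lt_rpow_iff (le_max_right _ _) (by positivity) hα, max_lt_iff,
    and_iff_left (inv_pos.2 hr), div_lt_iff_of_neg hB, inv_mul_lt_iff₀ hr]

theorem rpow_neg_le_iff {α r A : ℝ} (hα : 0 < α) (hr : 0 < r) :
    r ^ (-α) ≤ (max A 0) ^ α ↔ 1 ≤ r * A := by
  rw [Real.rpow_neg hr.le, ← Real.inv_rpow hr.le,
    Real.rpow_le_rpow_iff (by positivity) (le_max_right _ _) hα, le_max_iff,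
    or_iff_left (by have := inv_pos.2 hr; linarith), inv_le_iff_one_le_mul₀' hr]

/-- Since `x` is nonnegative and vanishes off `β`, the event forces the support of the projection to
be exactly `β`. There the projection is affine in `r`, and dividing by `|β| x_j - 1`, nonzero by
`hx1`, separates `β₊` from `β₋`. -/
theorem proj_smul_mem_iff {d : ℕ} {α : ℝ} (hα : 0 < α) {β : Finset (Fin d)} (hβ : β.Nonempty)
    {x : Fin d → ℝ} (hx : x ∈ closedFace β) (hx1 : ∀ j ∈ β, x j ≠ 1 / (β.card : ℝ))
    (θ : Fin d → ℝ) {r : ℝ} (hr : 0 < r) :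
    ((∀ j ∈ β, x j < proj (r • θ) j) ∧ ∀ j, j ∉ β → proj (r • θ) j ≤ x j) ↔
      (∀ j ∈ β.filter (fun j => 1 / (β.card : ℝ) < x j), r ^ (-α) < ratioTerm α β x θ j) ∧
      (∀ j ∈ β.filter (fun j => x j < 1 / (β.card : ℝ)), ratioTerm α β x θ j < r ^ (-α)) ∧
      ∀ j ∈ βᶜ, r ^ (-α) ≤ gapTerm α β θ j := by
  have hc : 0 < (β.card : ℝ) := by exact_mod_cast hβ.card_pos
  have hd : d ≠ 0 := by
    rintro rfl
    obtain ⟨j, _⟩ := hβ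
    exact j.elim0
  have hface : ∀ j, faceCoord β (r • θ) j = (r * (β.card * θ j - ∑ k ∈ β, θ k) + 1) / β.card :=
    fun j => by
      simp only [faceCoord, Pi.smul_apply, smul_eq_mul, ← Finset.mul_sum]
      field_simp
      ring
  have step1 : ((∀ j ∈ β, x j < proj (r • θ) j) ∧ ∀ j, j ∉ β → proj (r • θ) j ≤ x j) ↔
      (∀ j ∈ β, x j < faceCoord β (r • θ) j) ∧ ∀ j, j ∉ β → faceCoord β (r • θ) j ≤ 0 := by
    constructor
    · rintro ⟨h1, h2⟩
      have h1' : ∀ j ∈ β, 0 < proj (r • θ) j := fun j hj => (hx.1 j).trans_lt (h1 j hj)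
      have h2' : ∀ j, j ∉ β → proj (r • θ) j = 0 := fun j hj =>
        le_antisymm ((h2 j hj).trans_eq (hx.2.2 j hj)) ((proj_mem hd _).1 j)
      refine ⟨fun j hj => ?_, ((support_proj_iff hβ _).1 ⟨h1', h2'⟩).2⟩
      rw [← proj_apply_of_support hβ h1' h2' hj]
      exact h1 j hj
    · rintro ⟨h1, h2⟩
      rw [proj_eq_faceCoord hβ (fun j hj => ((hx.1 j).trans_lt (h1 j hj)).le) h2]
      exact ⟨fun j hj => lt_max_of_lt_left (h1 j hj),
        fun j hj => by rw [hx.2.2 j hj]; exact (max_eq_right (h2 j hj)).le⟩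
  have hin : ∀ j, x j < faceCoord β (r • θ) j ↔
      β.card * x j - 1 < r * (β.card * θ j - ∑ k ∈ β, θ k) := fun j => by
    rw [hface, lt_div_iff₀' hc, sub_lt_iff_lt_add]
  have hout : ∀ j, faceCoord β (r • θ) j ≤ 0 ↔ 1 ≤ r * (∑ k ∈ β, θ k - β.card * θ j) :=
    fun j => by
      rw [hface, div_le_iff₀ hc, zero_mul]
      constructor <;> intro h <;> linarith
  rw [step1]
  simp only [hin, hout, Finset.mem_filter, Finset.mem_compl, ratioTerm, gapTerm,
    rpow_neg_le_iff hα hr]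
  rw [← and_assoc]
  refine and_congr_left' ⟨fun h => ⟨fun j hj => ?_, fun j hj => ?_⟩, fun h j hj => ?_⟩
  · rw [rpow_neg_lt_iff hα hr]
    · exact h j hj.1
    · have := hj.2
      rw [div_lt_iff₀' hc] at this
      linarith
  · rw [lt_rpow_neg_iff hα hr]
    · exact h j hj.1
    · have := hj.2
      rw [lt_div_iff₀' hc] at this
      linarith
  · rcases lt_or_gt_of_ne (hx1 j hj) with h' | h'
    · refine (lt_rpow_neg_iff hα hr ?_).1 (h.2 j ⟨hj, h'⟩)
      rw [lt_div_iff₀' hc] at h'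
      linarith
    · refine (rpow_neg_lt_iff hα hr ?_).1 (h.1 j ⟨hj, h'⟩)
      rw [div_lt_iff₀' hc] at h'
      linarith

theorem measurable_proj_smul {d : ℕ} :
    Measurable fun p : ℝ × (Fin d → ℝ) => proj (p.1 • p.2) :=
  measurable_proj.comp (by fun_prop)

theorem measurableSet_G {d : ℕ} (β : Finset (Fin d)) (x : Fin d → ℝ) :
    MeasurableSet {z : Fin d → ℝ | (∀ j ∈ β, x j < z j) ∧ ∀ j, j ∉ β → z j ≤ x j} := by
  measurability

theorem pareto_real_proj_mem {d : ℕ} {α : ℝ} (hα : 0 < α) {β : Finset (Fin d)}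
    (hβ : β.Nonempty) {x : Fin d → ℝ} (hx : x ∈ closedFace β)
    (hx1 : ∀ j ∈ β, x j ≠ 1 / (β.card : ℝ)) (θ : Fin d → ℝ) :
    (paretoMeasure 1 α).real {r | (∀ j ∈ β, x j < proj (r • θ) j) ∧
      ∀ j, j ∉ β → proj (r • θ) j ≤ x j} = integrandG α β x θ := by
  set T : Set ℝ := {u |
      (∀ j ∈ β.filter (fun j => 1 / (β.card : ℝ) < x j), u < ratioTerm α β x θ j) ∧
      (∀ j ∈ β.filter (fun j => x j < 1 / (β.card : ℝ)), ratioTerm α β x θ j < u) ∧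
      ∀ j ∈ βᶜ, u ≤ gapTerm α β θ j} with hT
  have hTm : MeasurableSet T := by
    exact (measurableSet_forall_mem _ fun j _ => measurableSet_Iio).inter
      ((measurableSet_forall_mem _ fun j _ => measurableSet_Ioi).inter
        (measurableSet_forall_mem _ fun j _ => measurableSet_Iic))
  have h1 : (paretoMeasure 1 α) {r | (∀ j ∈ β, x j < proj (r • θ) j) ∧
      ∀ j, j ∉ β → proj (r • θ) j ≤ x j} = volume.restrict (Set.Ioc 0 1) T := by
    rw [← pareto_map_rpow hα, Measure.map_apply (by fun_prop) hTm]
    refine measure_congr ?_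
    filter_upwards [ae_pareto_one_le α] with r hr
    exact propext (proj_smul_mem_iff hα hβ hx hx1 θ (by linarith))
  rw [measureReal_def, h1, Measure.restrict_apply hTm]
  set M := min ((β.filter fun j => 1 / (β.card : ℝ) < x j).fold min 1 (ratioTerm α β x θ))
        (βᶜ.fold min 1 (gapTerm α β θ)) with hM
  set L := (β.filter fun j => x j < 1 / (β.card : ℝ)).fold max 0 (ratioTerm α β x θ) with hL
  -- Strict and weak inequalities are mixed in `T`, so only the interior and the closure of the
  -- interval are identified; both have length `(M - L)₊`.
  have hlo : Set.Ioo L M ⊆ T ∩ Set.Ioc 0 1 := by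
    rintro u ⟨hu1, hu2⟩
    rw [hL, Finset.fold_max_lt] at hu1
    rw [hM, lt_min_iff, Finset.lt_fold_min, Finset.lt_fold_min] at hu2
    exact ⟨⟨hu2.1.2, hu1.2, fun j hj => (hu2.2.2 j hj).le⟩, hu1.1, hu2.1.1.le⟩
  have hhi : T ∩ Set.Ioc 0 1 ⊆ Set.Icc L M := by
    rintro u ⟨⟨h1, h2, h3⟩, h4, h5⟩
    refine ⟨?_, ?_⟩
    · rw [hL, Finset.fold_max_le]
      exact ⟨h4.le, fun j hj => (h2 j hj).le⟩
    · rw [hM, le_min_iff, Finset.le_fold_min, Finset.le_fold_min]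
      exact ⟨⟨h5, fun j hj => (h1 j hj).le⟩, h5, h3⟩
  have hv : volume (T ∩ Set.Ioc 0 1) = ENNReal.ofReal (M - L) := by
    apply le_antisymm
    · simpa using measure_mono (μ := volume) hhi
    · simpa using measure_mono (μ := volume) hlo
  rw [hv, ENNReal.toReal_ofReal', integrandG]

theorem G_projLaw {d : ℕ} {α : ℝ} (hα : 0 < α) {S : Measure (Fin d → ℝ)}
    [IsProbabilityMeasure S] {β : Finset (Fin d)} (hβ : β.Nonempty) {x : Fin d → ℝ}
    (hx : x ∈ closedFace β) (hx1 : ∀ j ∈ β, x j ≠ 1 / (β.card : ℝ)) :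
    G (projLaw α S) β x = ∫ θ, integrandG α β x θ ∂S := by
  have := isProbabilityMeasure_paretoMeasure zero_lt_one hα
  have hm := measurable_proj_smul (measurableSet_G β x)
  rw [G, projLaw, measureReal_def, Measure.map_apply measurable_proj_smul (measurableSet_G β x),
    Measure.prod_apply_symm hm, ← integral_toReal]
  · exact integral_congr_ae (ae_of_all _ fun θ => pareto_real_proj_mem hα hβ hx hx1 θ)
  · exact (measurable_measure_prodMk_right hm).aemeasurable
  · exact ae_of_all _ fun _ => measure_lt_top _ _

/-! ### Conditional weak limits -/

section CondWeakLimit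

variable {Ω E E' : Type*} [MeasurableSpace Ω] [TopologicalSpace E] [MeasurableSpace E]
  [TopologicalSpace E'] [MeasurableSpace E'] {d : ℕ} {P : Measure Ω} {X : Ω → Fin d → ℝ}

theorem measurableSet_l1_gt (hXm : Measurable X) (t : ℝ) :
    MeasurableSet {ω | t < l1 (X ω)} :=
  measurableSet_lt measurable_const (continuous_l1.measurable.comp hXm)

theorem integral_cond_eq [IsFiniteMeasure P] (A : Set Ω) (u : Ω → ℝ) :
    ∫ ω, u ω ∂(cond P A) = (P.real A)⁻¹ * ∫ ω in A, u ω ∂P := by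
  rw [ProbabilityTheory.cond, integral_smul_measure, ENNReal.toReal_inv, smul_eq_mul, measureReal_def]

theorem CondWeakLimit.tail_ne_zero {F : ℝ → Ω → E} {ν : Measure E} [IsProbabilityMeasure ν]
    (h : CondWeakLimit P X F ν) (t : ℝ) : P {ω | t < l1 (X ω)} ≠ 0 := by
  intro h0
  have h1 := h 1
  simp only [BoundedContinuousFunction.coe_one, Pi.one_apply, integral_const, probReal_univ,
    smul_eq_mul, mul_one] at h1
  have h2 : ∀ᶠ s in atTop, (cond P {ω | s < l1 (X ω)}).real Set.univ = 0 := by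
    filter_upwards [eventually_ge_atTop t] with s hs
    have h3 : P {ω | s < l1 (X ω)} = 0 :=
      measure_mono_null (fun ω (hω : s < l1 (X ω)) => hs.trans_lt hω) h0
    rw [cond_eq_zero_of_meas_eq_zero h3]
    simp
  have := tendsto_nhds_unique_of_eventuallyEq h1 tendsto_const_nhds h2
  norm_num at this

theorem CondWeakLimit.comp [OpensMeasurableSpace E] [BorelSpace E'] {F : ℝ → Ω → E}
    {ν : Measure E} (h : CondWeakLimit P X F ν) {g : E → E'} (hg : Continuous g) :
    CondWeakLimit P X (fun t ω => g (F t ω)) (ν.map g) := by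
  intro f
  rw [integral_map hg.measurable.aemeasurable f.continuous.measurable.aestronglyMeasurable]
  exact h (f.compContinuous ⟨g, hg⟩)

theorem CondWeakLimit.congr (hXm : Measurable X) {F F' : ℝ → Ω → E} {ν : Measure E}
    (h : CondWeakLimit P X F ν)
    (hF : ∀ᶠ t in atTop, ∀ ω, t < l1 (X ω) → F t ω = F' t ω) : CondWeakLimit P X F' ν := by
  intro f
  refine (h f).congr' ?_
  filter_upwards [hF] with t ht
  refine integral_congr_ae ?_
  filter_upwards [ae_cond_mem (measurableSet_l1_gt hXm t)] with ω hω
  rw [ht ω hω]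

theorem CondWeakLimit.unique [HasOuterApproxClosed E] [BorelSpace E] {F : ℝ → Ω → E}
    {ν ν' : Measure E} [IsFiniteMeasure ν] [IsFiniteMeasure ν']
    (h : CondWeakLimit P X F ν) (h' : CondWeakLimit P X F ν') : ν = ν' :=
  ext_of_forall_integral_eq_of_IsFiniteMeasure fun f => tendsto_nhds_unique (h f) (h' f)

theorem isProbabilityMeasure_cond_tail [IsFiniteMeasure P]
    (hpos : ∀ t, P {ω | t < l1 (X ω)} ≠ 0) (t : ℝ) :
    IsProbabilityMeasure (cond P {ω | t < l1 (X ω)}) :=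
  cond_isProbabilityMeasure (hpos t)

/-- The conditional law of `F t` given `|X| > t`. -/
def condLaw [IsFiniteMeasure P] (hpos : ∀ t, P {ω | t < l1 (X ω)} ≠ 0) {F : ℝ → Ω → E}
    (hF : ∀ t, Measurable (F t)) (t : ℝ) : ProbabilityMeasure E :=
  ⟨(cond P {ω | t < l1 (X ω)}).map (F t),
    have := isProbabilityMeasure_cond_tail hpos t
    Measure.isProbabilityMeasure_map (hF t).aemeasurable⟩

theorem integral_condLaw [OpensMeasurableSpace E] [IsFiniteMeasure P]
    (hpos : ∀ t, P {ω | t < l1 (X ω)} ≠ 0)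
    {F : ℝ → Ω → E} (hF : ∀ t, Measurable (F t)) (t : ℝ) {f : E → ℝ} (hf : Continuous f) :
    ∫ e, f e ∂(condLaw hpos hF t : Measure E) =
      ∫ ω, f (F t ω) ∂(cond P {ω | t < l1 (X ω)}) :=
  integral_map (hF t).aemeasurable hf.measurable.aestronglyMeasurable

theorem condWeakLimit_iff [OpensMeasurableSpace E] [IsFiniteMeasure P]
    (hpos : ∀ t, P {ω | t < l1 (X ω)} ≠ 0)
    {F : ℝ → Ω → E} (hF : ∀ t, Measurable (F t)) {ν : ProbabilityMeasure E} :
    CondWeakLimit P X F (ν : Measure E) ↔ Tendsto (condLaw hpos hF) atTop (𝓝 ν) := by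
  rw [ProbabilityMeasure.tendsto_iff_forall_integral_tendsto]
  refine forall_congr' fun f => ?_
  simp only [integral_condLaw hpos hF _ f.continuous]

end CondWeakLimit

/-! ### From regular variation to sparse regular variation -/

section

variable {Ω : Type*} [MeasurableSpace Ω] {d : ℕ} {P : Measure Ω} {X : Ω → Fin d → ℝ}

theorem ne_zero_of_ae_mem_simplex {S : Measure (Fin d → ℝ)} [IsProbabilityMeasure S]
    (h : ∀ᵐ θ ∂S, θ ∈ simplex d) : d ≠ 0 := by
  obtain ⟨θ, hθ⟩ := h.exists
  exact ne_zero_of_mem_simplex hθ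

theorem isProbabilityMeasure_projLaw {α : ℝ} (hα : 0 < α) (S : Measure (Fin d → ℝ))
    [IsProbabilityMeasure S] : IsProbabilityMeasure (projLaw α S) := by
  have := isProbabilityMeasure_paretoMeasure zero_lt_one hα
  exact Measure.isProbabilityMeasure_map measurable_proj_smul.aemeasurable

theorem RV.sRV (hXm : Measurable X) {α : ℝ} {S : Measure (Fin d → ℝ)} (h : RV P X α S) :
    SRV P X α (projLaw α S) := by
  obtain ⟨hα, hS, hSs, hlim⟩ := h
  have := isProbabilityMeasure_paretoMeasure zero_lt_one hα
  have hd := ne_zero_of_ae_mem_simplex hSs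
  have hg : Continuous fun p : ℝ × (Fin d → ℝ) => (p.1, proj (p.1 • p.2)) :=
    continuous_fst.prodMk (continuous_proj.comp (by fun_prop))
  set ν := ((paretoMeasure 1 α).prod S).map fun p : ℝ × (Fin d → ℝ) => (p.1, proj (p.1 • p.2))
    with hν
  have hfst : ν.fst = paretoMeasure 1 α := by
    rw [Measure.fst, hν, Measure.map_map measurable_fst hg.measurable]
    exact Measure.fst_prod
  have hsnd : ν.snd = projLaw α S := by
    rw [Measure.snd, hν, Measure.map_map measurable_snd hg.measurable]
    rfl
  refine ⟨hα, ν, ⟨Measure.isProbabilityMeasure_map hg.measurable.aemeasurable, ?_, ?_, ?_⟩,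
    hfst, hsnd⟩
  · rw [hν, ae_map_iff hg.measurable.aemeasurable (isClosed_simplex.measurableSet.preimage
      measurable_snd)]
    exact ae_of_all _ fun p => proj_mem hd _
  · intro a ha
    have h1 : paretoMeasure 1 α {a} = 0 := measure_singleton a
    rw [← hfst, ha] at h1
    simp at h1
  · refine (hlim.comp hg).congr hXm ?_
    filter_upwards [eventually_gt_atTop 0] with t ht ω hω
    have h0 : l1 (X ω) ≠ 0 := (ht.trans hω).ne'
    simp only [smul_smul]
    congr 3
    field_simp

/-! ### Limits of the radial part -/

theorem tail_pos [IsFiniteMeasure P] (hpos : ∀ t, P {ω | t < l1 (X ω)} ≠ 0) (t : ℝ) :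
    0 < P.real {ω | t < l1 (X ω)} :=
  ENNReal.toReal_pos (hpos t) (measure_ne_top _ _)

theorem tendsto_tail [IsFiniteMeasure P] (hXm : Measurable X) :
    Tendsto (fun t : ℝ => P.real {ω | t < l1 (X ω)}) atTop (𝓝 0) := by
  have h := tendsto_measure_iInter_atTop (μ := P) (s := fun t : ℝ => {ω | t < l1 (X ω)})
    (fun t => (measurableSet_l1_gt hXm t).nullMeasurableSet)
    (fun s t hst ω hω => lt_of_le_of_lt hst hω) ⟨0, measure_ne_top _ _⟩
  have h0 : ⋂ t : ℝ, {ω | t < l1 (X ω)} = ∅ := by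
    ext ω
    simp only [Set.mem_iInter, Set.mem_ofPred_eq, Set.mem_empty_iff_false, iff_false, not_forall,
      not_lt]
    exact ⟨_, le_rfl⟩
  rw [h0, measure_empty] at h
  exact (ENNReal.tendsto_toReal ENNReal.zero_ne_top).comp h

theorem cond_tail_real [IsFiniteMeasure P] (hXm : Measurable X) {t s : ℝ} (hts : t ≤ s) :
    (cond P {ω | t < l1 (X ω)}).real {ω | s < l1 (X ω)} =
      P.real {ω | s < l1 (X ω)} / P.real {ω | t < l1 (X ω)} := by
  rw [measureReal_def, cond_apply (measurableSet_l1_gt hXm t), ENNReal.toReal_mul,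
    ENNReal.toReal_inv, Set.inter_eq_self_of_subset_right
    (show {ω | s < l1 (X ω)} ⊆ {ω | t < l1 (X ω)} from fun ω hω => hts.trans_lt hω),
    inv_mul_eq_div, measureReal_def, measureReal_def]

/-- Multiplicative functions on `[1, ∞)` are powers. -/
theorem eq_rpow_of_mul {ρ : ℝ → ℝ} (hc : ContinuousOn ρ (Set.Ici 1)) (h1 : ρ 1 = 1)
    (hmul : ∀ x y, 1 ≤ x → 1 ≤ y → ρ (x * y) = ρ x * ρ y) (h0 : Tendsto ρ atTop (𝓝 0)) :
    ∃ α : ℝ, 0 < α ∧ ∀ s, 1 ≤ s → ρ s = s ^ (-α) := by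
  have hsq : ∀ s, 1 ≤ s → ρ s = ρ (√s) ^ 2 := fun s hs => by
    rw [sq, ← hmul _ _ (Real.one_le_sqrt.2 hs) (Real.one_le_sqrt.2 hs),
      Real.mul_self_sqrt (by linarith)]
  -- A zero at `s` would propagate to all iterated square roots of `s`, which tend to `1`,
  -- contradicting continuity and `ρ 1 = 1`.
  have hne : ∀ s, 1 ≤ s → ρ s ≠ 0 := by
    intro s hs hz
    have hz' : ∀ n : ℕ, ρ (s ^ ((1 / 2 : ℝ) ^ n)) = 0 := by
      intro n
      induction n with
      | zero => simpa using hz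
      | succ n ih =>
        rw [hsq _ (Real.one_le_rpow hs (by positivity)), Real.sqrt_eq_rpow,
          ← Real.rpow_mul (by linarith), ← pow_succ] at ih
        exact pow_eq_zero_iff two_ne_zero |>.1 ih
    have hlim : Tendsto (fun n : ℕ => s ^ ((1 / 2 : ℝ) ^ n)) atTop (𝓝 1) := by
      have := (Real.continuousAt_const_rpow (a := s) (b := 0) (by linarith)).tendsto.comp
        (tendsto_pow_atTop_nhds_zero_of_lt_one (r := (1 / 2 : ℝ)) (by norm_num) (by norm_num))
      simpa [Function.comp_def] using this
    have h2 := (hc 1 Set.self_mem_Ici).tendsto.comp (tendsto_nhdsWithin_iff.2 ⟨hlim,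
      Eventually.of_forall fun n => Set.mem_Ici.2 (Real.one_le_rpow hs (by positivity))⟩)
    have h3 := tendsto_nhds_unique h2 (tendsto_const_nhds.congr fun n => (hz' n).symm)
    rw [h1] at h3
    norm_num at h3
  have hpos : ∀ s, 1 ≤ s → 0 < ρ s := fun s hs =>
    lt_of_le_of_ne (by rw [hsq s hs]; positivity) (hne s hs).symm
  -- In logarithmic coordinates `ρ` becomes a continuous additive function on the half-line. Its odd
  -- extension `f` below is additive on the whole line, hence linear.
  set g : ℝ → ℝ := fun u => Real.log (ρ (Real.exp (max u 0))) with hg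
  have hexp : ∀ u, 1 ≤ Real.exp (max u 0) := fun u => Real.one_le_exp (le_max_right _ _)
  have hgadd : ∀ u v, 0 ≤ u → 0 ≤ v → g (u + v) = g u + g v := fun u v hu hv => by
    simp only [hg, max_eq_left hu, max_eq_left hv, max_eq_left (add_nonneg hu hv), Real.exp_add]
    rw [hmul _ _ (Real.one_le_exp hu) (Real.one_le_exp hv),
      Real.log_mul (hne _ (Real.one_le_exp hu)) (hne _ (Real.one_le_exp hv))]
  have hgc : Continuous g :=
    (hc.comp_continuous (by fun_prop) hexp).log fun u => hne _ (hexp u)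
  have hsub : ∀ a b, 0 ≤ a → 0 ≤ b → g (max (a - b) 0) - g (max (b - a) 0) = g a - g b := by
    intro a b ha hb
    have h := hgadd a (max (b - a) 0) ha (le_max_right _ _)
    have h' := hgadd b (max (a - b) 0) hb (le_max_right _ _)
    have h'' : a + max (b - a) 0 = b + max (a - b) 0 := by
      rcases le_total a b with hab | hab
      · rw [max_eq_left (by linarith), max_eq_right (by linarith)]; ring
      · rw [max_eq_right (by linarith), max_eq_left (by linarith)]; ring
    rw [h''] at h
    linarith
  have g0 : g 0 = 0 := by simp [hg, h1]
  let f : ℝ →+ ℝ :=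
    { toFun := fun u => g (max u 0) - g (max (-u) 0)
      map_zero' := by simp
      map_add' := fun u v => by
        have h := hsub (max u 0 + max v 0) (max (-u) 0 + max (-v) 0) (by positivity)
          (by positivity)
        have hdec : ∀ x : ℝ, x = max x 0 - max (-x) 0 := fun x => by
          rcases le_total x 0 with hx | hx
          · rw [max_eq_right hx, max_eq_left (by linarith)]; ring
          · rw [max_eq_left hx, max_eq_right (by linarith)]; ring
        rw [hgadd _ _ (le_max_right _ _) (le_max_right _ _),
          hgadd _ _ (le_max_right _ _) (le_max_right _ _)] at h
        have e1 : max u 0 + max v 0 - (max (-u) 0 + max (-v) 0) = u + v := by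
          linarith [hdec u, hdec v]
        have e2 : max (-u) 0 + max (-v) 0 - (max u 0 + max v 0) = -(u + v) := by
          linarith [hdec u, hdec v]
        rw [e1, e2] at h
        linarith }
  have hfc : Continuous f := by
    change Continuous fun u => g (max u 0) - g (max (-u) 0)
    fun_prop
  have hlin : ∀ u : ℝ, f u = u * f 1 := fun u => by
    simpa using (f.toRealLinearMap hfc).map_smul u 1
  have hρ : ∀ s, 1 ≤ s → ρ s = s ^ (- -(f 1)) := fun s hs => by
    have hl := Real.log_nonneg hs
    have h2 : f (Real.log s) = Real.log (ρ s) := by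
      change g (max (Real.log s) 0) - g (max (-Real.log s) 0) = _
      rw [max_eq_left hl, max_eq_right (by linarith), g0, sub_zero, hg]
      simp only [max_eq_left hl, Real.exp_log (by linarith : 0 < s)]
    rw [Real.rpow_def_of_pos (by linarith), neg_neg, ← hlin, h2, Real.exp_log (hpos s hs)]
  refine ⟨-(f 1), ?_, hρ⟩
  by_contra! hle
  have h4 : ∀ᶠ s in atTop, 1 ≤ ρ s := by
    filter_upwards [eventually_ge_atTop 1] with s hs
    rw [hρ s hs]
    exact Real.one_le_rpow hs (by linarith)
  have := ge_of_tendsto h0 h4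
  norm_num at this

theorem CondWeakLimit.tendsto {E : Type*} [TopologicalSpace E] [MeasurableSpace E]
    {F : ℝ → Ω → E} {ν : Measure E} (h : CondWeakLimit P X F ν) {f : E → ℝ} (hf : Continuous f)
    {C : ℝ} (hC : ∀ e, |f e| ≤ C) :
    Tendsto (fun t : ℝ => ∫ ω, f (F t ω) ∂(ProbabilityTheory.cond P {ω | t < l1 (X ω)}))
      atTop (𝓝 (∫ e, f e ∂ν)) :=
  h (BoundedContinuousFunction.ofNormedAddCommGroup f hf C hC)

/-- Raising the conditioning level from `t` to `s` only changes the normalisation when the integrand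
vanishes up to `s`. -/
theorem integral_cond_tail [IsFiniteMeasure P] (hXm : Measurable X)
    (hpos : ∀ t, P {ω | t < l1 (X ω)} ≠ 0) {t s : ℝ} (hts : t ≤ s) {u : Ω → ℝ}
    (hu : ∀ ω, l1 (X ω) ≤ s → u ω = 0) :
    ∫ ω, u ω ∂(ProbabilityTheory.cond P {ω | t < l1 (X ω)}) =
      P.real {ω | s < l1 (X ω)} / P.real {ω | t < l1 (X ω)} *
        ∫ ω, u ω ∂(ProbabilityTheory.cond P {ω | s < l1 (X ω)}) := by
  have h1 := (tail_pos hpos s).ne'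
  have h2 : ∫ ω in {ω | t < l1 (X ω)}, u ω ∂P = ∫ ω in {ω | s < l1 (X ω)}, u ω ∂P :=
    setIntegral_eq_of_subset_of_forall_sdiff_eq_zero (measurableSet_l1_gt hXm t)
      (fun ω hω => hts.trans_lt hω) fun ω hω => hu ω (not_lt.1 hω.2)
  rw [integral_cond_eq, integral_cond_eq, h2]
  field_simp

/-- The continuous function which is `0` up to `1`, and then increases to `1` with slope one. -/
def ramp (r : ℝ) : ℝ := min (max (r - 1) 0) 1

theorem continuous_ramp : Continuous ramp := by unfold ramp; fun_prop

theorem ramp_nonneg (r : ℝ) : 0 ≤ ramp r := le_min (le_max_right _ _) zero_le_one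

theorem abs_ramp_le (r : ℝ) : |ramp r| ≤ 1 := by
  rw [abs_of_nonneg (ramp_nonneg r)]; exact min_le_right _ _

theorem ramp_eq_zero_iff {r : ℝ} : ramp r = 0 ↔ r ≤ 1 := by
  unfold ramp
  constructor
  · intro h
    by_contra! hr
    rw [max_eq_left (by linarith)] at h
    rcases min_choice (r - 1) 1 with h' | h' <;> rw [h'] at h <;> linarith
  · intro h
    rw [max_eq_right (by linarith), min_eq_left zero_le_one]

theorem measurable_radial (hXm : Measurable X) (t : ℝ) : Measurable fun ω => l1 (X ω) / t :=
  (continuous_l1.measurable.comp hXm).div_const t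

theorem condLaw_radial_Ioi [IsFiniteMeasure P] (hXm : Measurable X)
    (hpos : ∀ t, P {ω | t < l1 (X ω)} ≠ 0) {t s : ℝ} (ht : 0 < t) (hs : 1 ≤ s) :
    (condLaw hpos (measurable_radial hXm) t : Measure ℝ) (Set.Ioi s) =
      ENNReal.ofReal (P.real {ω | t * s < l1 (X ω)} / P.real {ω | t < l1 (X ω)}) := by
  have := isProbabilityMeasure_cond_tail hpos t
  rw [← cond_tail_real hXm (by nlinarith), ofReal_measureReal]
  refine (Measure.map_apply (measurable_radial hXm t) measurableSet_Ioi).trans ?_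
  congr 1
  ext ω
  change s < l1 (X ω) / t ↔ t * s < l1 (X ω)
  rw [lt_div_iff₀' ht]

/-- The test function is positive exactly below `1`, while the conditioned radius exceeds `1`. -/
theorem CondWeakLimit.ae_one_le [IsProbabilityMeasure P] (hXm : Measurable X) {m : Measure ℝ}
    [IsProbabilityMeasure m] (h : CondWeakLimit P X (fun t ω => l1 (X ω) / t) m) :
    ∀ᵐ r ∂m, 1 ≤ r := by
  have hc : Continuous fun r : ℝ => min (max (1 - r) 0) 1 := by fun_prop
  have h0 : ∀ r : ℝ, 0 ≤ min (max (1 - r) 0) 1 := fun r => le_min (le_max_right _ _) zero_le_one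
  have hb : ∀ r : ℝ, |min (max (1 - r) 0) 1| ≤ 1 := fun r => by
    rw [abs_of_nonneg (h0 r)]; exact min_le_right _ _
  have h1 := h.tendsto hc hb
  have h2 : ∀ᶠ t : ℝ in atTop, ∫ ω, min (max (1 - l1 (X ω) / t) 0) 1
      ∂(ProbabilityTheory.cond P {ω | t < l1 (X ω)}) = 0 := by
    filter_upwards [eventually_gt_atTop 0] with t ht
    rw [integral_eq_zero_of_ae]
    filter_upwards [ae_cond_mem (measurableSet_l1_gt hXm t)] with ω hω
    have : 1 ≤ l1 (X ω) / t := (one_le_div ht).2 (le_of_lt hω)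
    rw [max_eq_right (by linarith), min_eq_left zero_le_one, Pi.zero_apply]
  have h3 := tendsto_nhds_unique_of_eventuallyEq h1 tendsto_const_nhds h2
  rw [integral_eq_zero_iff_of_nonneg h0 (.of_bound hc.aestronglyMeasurable 1 (ae_of_all _ hb))]
    at h3
  filter_upwards [h3] with r hr
  by_contra! hlt
  simp only [Pi.zero_apply] at hr
  rw [max_eq_left (by linarith)] at hr
  rcases min_choice (1 - r) 1 with h' | h' <;> rw [h'] at hr <;> linarith

/-- A nondegenerate limit of the radial part is Pareto distributed. -/
theorem CondWeakLimit.exists_pareto [IsProbabilityMeasure P] (hXm : Measurable X)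
    {m : Measure ℝ} [IsProbabilityMeasure m]
    (h : CondWeakLimit P X (fun t ω => l1 (X ω) / t) m) (hnd : ∀ a, m ≠ Measure.dirac a) :
    ∃ α : ℝ, 0 < α ∧ m = paretoMeasure 1 α := by
  have hpos := h.tail_ne_zero
  have h1 := h.ae_one_le hXm
  set F : ℝ → ℝ := fun t => P.real {ω | t < l1 (X ω)} with hF
  have hFpos : ∀ t, 0 < F t := tail_pos hpos
  set I : ℝ → ℝ := fun s => ∫ r, ramp (r / s) ∂m with hI
  have hint : ∀ s, Integrable (fun r => ramp (r / s)) m := fun s =>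
    .of_bound (continuous_ramp.comp (by fun_prop)).aestronglyMeasurable 1
      (ae_of_all _ fun r => abs_ramp_le _)
  -- This is where nondegeneracy enters: `I 1 = 0` would concentrate `m` at `1`.
  have hc : 0 < I 1 := by
    refine lt_of_le_of_ne (integral_nonneg fun r => ramp_nonneg _) fun h0 => ?_
    have h2 := (integral_eq_zero_iff_of_nonneg (fun r => ramp_nonneg _) (hint 1)).1 h0.symm
    have h3 : id =ᵐ[m] fun _ => (1 : ℝ) := by
      filter_upwards [h1, h2] with r hr hr'
      simp only [div_one, Pi.zero_apply, ramp_eq_zero_iff] at hr'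
      exact le_antisymm hr' hr
    refine hnd 1 ?_
    rw [← Measure.map_id (μ := m), Measure.map_congr h3, Measure.map_const, measure_univ, one_smul]
  -- The ramp at level `t * s` can be integrated given `|X| > t` or given `|X| > t * s`; the two
  -- values differ by the factor `F (t * s) / F t`, and both converge. A continuous ramp avoids
  -- assuming that `m` has no atoms.
  have hratio : ∀ s, 1 ≤ s → Tendsto (fun t => F (t * s) / F t) atTop (𝓝 (I s / I 1)) := by
    intro s hs
    have hs0 : 0 < s := by linarith
    have hA := h.tendsto (f := fun r => ramp (r / s)) (continuous_ramp.comp (by fun_prop))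
      fun r => abs_ramp_le _
    have hB := (h.tendsto (f := fun r => ramp (r / 1)) (continuous_ramp.comp (by fun_prop))
      fun r => abs_ramp_le _).comp (tendsto_id.atTop_mul_const hs0)
    refine (hA.div hB hc.ne').congr' ?_
    have hB' := hB.eventually (lt_mem_nhds hc)
    filter_upwards [eventually_gt_atTop 0, hB'] with t ht hpos'
    simp only [Function.comp_apply, id_eq, div_one] at hpos' ⊢
    simp only [Pi.div_apply, Function.comp_apply, div_div]
    rw [integral_cond_tail hXm hpos (by nlinarith : t ≤ t * s), mul_div_cancel_right₀ _ hpos'.ne']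
    intro ω hω
    rw [ramp_eq_zero_iff]
    exact (div_le_one (by positivity)).2 hω
  -- Pass to the limit in `F(txy)/F(t) = (F(tx)/F(t)) * (F(txy)/F(tx))`.
  have hmul : ∀ x y, 1 ≤ x → 1 ≤ y → I (x * y) / I 1 = I x / I 1 * (I y / I 1) := by
    intro x y hx hy
    have h2 := (hratio x hx).mul ((hratio y hy).comp (tendsto_id.atTop_mul_const
      (by linarith : 0 < x)))
    refine tendsto_nhds_unique (hratio (x * y) (by nlinarith)) (h2.congr fun t => ?_)
    have := (hFpos (t * x)).ne'
    have := (hFpos t).ne'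
    simp only [Function.comp_apply, id_eq, mul_assoc] at *
    field_simp
  have hcont : ContinuousOn (fun s => I s / I 1) (Set.Ici 1) := by
    refine ContinuousOn.div_const ?_ _
    refine continuousOn_of_dominated (bound := fun _ => 1) (fun s _ => (hint s).1)
      (fun s _ => ae_of_all _ fun r => abs_ramp_le _) (integrable_const _)
      (ae_of_all _ fun r => ?_)
    refine continuous_ramp.comp_continuousOn (continuousOn_const.div continuousOn_id ?_)
    intro s hs
    have : (1 : ℝ) ≤ s := hs
    exact (show (0 : ℝ) < s by linarith).ne'
  have hlim0 : Tendsto (fun s => I s / I 1) atTop (𝓝 0) := by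
    rw [← zero_div (I 1)]
    refine Tendsto.div_const ?_ _
    have h0 : (0 : ℝ) = ∫ _, ramp 0 ∂m := by simp [ramp]
    rw [h0]
    refine tendsto_integral_filter_of_dominated_convergence (fun _ => 1)
      (Eventually.of_forall fun s => (hint s).1)
      (Eventually.of_forall fun s => ae_of_all _ fun r => abs_ramp_le _) (integrable_const _)
      (ae_of_all _ fun r => (continuous_ramp.tendsto 0).comp
        (tendsto_const_nhds.div_atTop tendsto_id))
  obtain ⟨α, hα, hρ⟩ := eq_rpow_of_mul hcont (div_self hc.ne') hmul hlim0
  refine ⟨α, hα, ?_⟩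
  have hlaw := (condWeakLimit_iff hpos (measurable_radial hXm) (ν := ⟨m, inferInstance⟩)).1 h
  have hIoi : ∀ s, 1 ≤ s → Tendsto (fun t => (condLaw hpos (measurable_radial hXm) t : Measure ℝ)
      (Set.Ioi s)) atTop (𝓝 (ENNReal.ofReal (s ^ (-α)))) := by
    intro s hs
    rw [← hρ s hs]
    refine (ENNReal.tendsto_ofReal (hratio s hs)).congr' ?_
    filter_upwards [eventually_gt_atTop 0] with t ht
    rw [condLaw_radial_Ioi hXm hpos ht hs]
  have hup : ∀ s, 1 ≤ s → m (Set.Ioi s) ≤ ENNReal.ofReal (s ^ (-α)) := fun s hs =>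
    (ProbabilityMeasure.le_liminf_measure_open_of_tendsto hlaw isOpen_Ioi).trans_eq
      (hIoi s hs).liminf_eq
  have hlo : ∀ s, 1 ≤ s → ENNReal.ofReal (s ^ (-α)) ≤ m (Set.Ici s) := fun s hs =>
    (hIoi s hs).limsup_eq.symm.trans_le ((limsup_le_limsup (Eventually.of_forall fun t =>
      measure_mono Set.Ioi_subset_Ici_self)).trans
        (ProbabilityMeasure.limsup_measure_closed_le_of_tendsto hlaw isClosed_Ici))
  have := isProbabilityMeasure_paretoMeasure zero_lt_one hα
  refine Measure.ext_of_Ici _ _ fun a => ?_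
  rw [pareto_Ici_max hα]
  rcases le_or_gt a 1 with ha | ha
  · rw [max_eq_right ha, Real.one_rpow, ENNReal.ofReal_one, ← measure_univ (μ := m)]
    refine measure_congr ?_
    filter_upwards [h1] with r hr
    exact propext ⟨fun _ => trivial, fun _ => ha.trans hr⟩
  · rw [max_eq_left ha.le]
    refine le_antisymm ?_ (hlo a ha.le)
    -- The open half-lines only bound `m (Ioi s)`; letting `s` increase to `a` transfers the bound
    -- to the closed half-line, so possible atoms of `m` do no harm.
    have h5 : Tendsto (fun s : ℝ => ENNReal.ofReal (s ^ (-α))) (𝓝[<] a)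
        (𝓝 (ENNReal.ofReal (a ^ (-α)))) :=
      ENNReal.tendsto_ofReal (((Real.continuousAt_rpow_const a (-α)
        (Or.inl (by linarith))).tendsto).mono_left nhdsWithin_le_nhds)
    refine ge_of_tendsto h5 ?_
    filter_upwards [Ioo_mem_nhdsLT ha] with s hs
    exact (measure_mono fun r hr => hs.2.trans_le hr).trans (hup s hs.1.le)

/-! ### Convergence of the angular part -/

theorem CondWeakLimit.tendsto_tail_ratio [IsProbabilityMeasure P] (hXm : Measurable X) {α : ℝ}
    (hα : 0 < α) (h : CondWeakLimit P X (fun t ω => l1 (X ω) / t) (paretoMeasure 1 α)) {s : ℝ}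
    (hs : 1 ≤ s) :
    Tendsto (fun t => P.real {ω | t * s < l1 (X ω)} / P.real {ω | t < l1 (X ω)}) atTop
      (𝓝 (s ^ (-α))) := by
  have := isProbabilityMeasure_paretoMeasure zero_lt_one hα
  have hpos := h.tail_ne_zero
  have hlaw := (condWeakLimit_iff hpos (measurable_radial hXm)
    (ν := ⟨paretoMeasure 1 α, inferInstance⟩)).1 h
  have h1 : Tendsto (fun t => (condLaw hpos (measurable_radial hXm) t : Measure ℝ) (Set.Ioi s))
      atTop (𝓝 (paretoMeasure 1 α (Set.Ioi s))) :=
    ProbabilityMeasure.tendsto_measure_of_null_frontier_of_tendsto' hlaw (by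
      rw [frontier_Ioi]
      exact measure_singleton (μ := paretoMeasure 1 α) s)
  have h2 := (ENNReal.tendsto_toReal (measure_ne_top _ _)).comp h1
  have h3 := pareto_real_Ioi hα hs
  rw [measureReal_def] at h3
  rw [h3] at h2
  refine h2.congr' ?_
  filter_upwards [eventually_gt_atTop 0] with t ht
  rw [Function.comp_apply, condLaw_radial_Ioi hXm hpos ht hs,
    ENNReal.toReal_ofReal (by positivity)]

theorem integral_eq_tail_mul [IsFiniteMeasure P] (hpos : ∀ t, P {ω | t < l1 (X ω)} ≠ 0)
    {t : ℝ} {u : Ω → ℝ} (hu : ∀ ω, l1 (X ω) ≤ t → u ω = 0) :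
    ∫ ω, u ω ∂P = P.real {ω | t < l1 (X ω)} *
      ∫ ω, u ω ∂(ProbabilityTheory.cond P {ω | t < l1 (X ω)}) := by
  rw [integral_cond_eq, mul_inv_cancel_left₀ (tail_pos hpos t).ne']
  exact (setIntegral_eq_integral_of_forall_compl_eq_zero fun ω hω => hu ω (not_lt.1 hω)).symm

/-- The continuous function which is `0` up to `1`, is `1` from `q` on, and is affine between. -/
def rampTo (q r : ℝ) : ℝ := min (max ((r - 1) / (q - 1)) 0) 1

theorem continuous_rampTo (q : ℝ) : Continuous (rampTo q) := by unfold rampTo; fun_prop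

theorem rampTo_nonneg (q r : ℝ) : 0 ≤ rampTo q r := le_min (le_max_right _ _) zero_le_one

theorem rampTo_le_one (q r : ℝ) : rampTo q r ≤ 1 := min_le_right _ _

theorem rampTo_mono {q : ℝ} (hq : 1 < q) : Monotone (rampTo q) := fun r s h =>
  min_le_min_right _ (max_le_max_right _
    (div_le_div_of_nonneg_right (by linarith) (by linarith)))

theorem rampTo_of_le {q r : ℝ} (hq : 1 < q) (hr : r ≤ 1) : rampTo q r = 0 := by
  rw [rampTo, max_eq_right (div_nonpos_of_nonpos_of_nonneg (by linarith) (by linarith)),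
    min_eq_left zero_le_one]

theorem rampTo_of_ge {q r : ℝ} (hq : 1 < q) (hr : q ≤ r) : rampTo q r = 1 := by
  have : 1 ≤ (r - 1) / (q - 1) := (one_le_div (by linarith)).2 (by linarith)
  rw [rampTo, max_eq_left (by linarith), min_eq_right this]

theorem rampTo_pos {q r : ℝ} (hq : 1 < q) (hr : 1 < r) : 0 < rampTo q r :=
  lt_min (lt_max_of_lt_left (div_pos (by linarith) (by linarith))) one_pos

/-- A continuous bump supported on `[1, q ^ 2]`. -/
def bump (q r : ℝ) : ℝ := rampTo q r - rampTo q (r / q)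

theorem continuous_bump (q : ℝ) : Continuous (bump q) :=
  (continuous_rampTo q).sub ((continuous_rampTo q).comp (by fun_prop))

theorem abs_bump_le (q r : ℝ) : |bump q r| ≤ 1 := by
  have := rampTo_nonneg q r
  have := rampTo_nonneg q (r / q)
  have := rampTo_le_one q r
  have := rampTo_le_one q (r / q)
  rw [bump, abs_le]
  constructor <;> linarith

theorem bump_nonneg {q r : ℝ} (hq : 1 < q) (hr : 0 ≤ r) : 0 ≤ bump q r :=
  sub_nonneg.2 (rampTo_mono hq (div_le_self hr hq.le))

theorem bump_of_le {q r : ℝ} (hq : 1 < q) (hr : r ≤ 1) : bump q r = 0 := by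
  rw [bump, rampTo_of_le hq hr, rampTo_of_le hq, sub_zero]
  rw [div_le_one (by linarith)]
  linarith

theorem bump_of_ge {q r : ℝ} (hq : 1 < q) (hr : q ^ 2 ≤ r) : bump q r = 0 := by
  rw [bump, rampTo_of_ge hq (by nlinarith), rampTo_of_ge hq, sub_self]
  rw [le_div_iff₀ (by linarith)]
  linarith [sq q]

theorem bump_pos {q r : ℝ} (hq : 1 < q) (hr : 1 < r) (hr' : r ≤ q) : 0 < bump q r := by
  rw [bump, rampTo_of_le hq (r := r / q), sub_zero]
  · exact rampTo_pos hq hr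
  · rwa [div_le_one (by linarith)]

theorem integral_bump_pos {α q : ℝ} (hα : 0 < α) (hq : 1 < q) :
    0 < ∫ r, bump q r ∂paretoMeasure 1 α := by
  have := isProbabilityMeasure_paretoMeasure zero_lt_one hα
  have h0 : 0 ≤ᵐ[paretoMeasure 1 α] bump q := by
    filter_upwards [ae_pareto_one_le α] with r hr
    exact bump_nonneg hq (by linarith)
  have hi : Integrable (bump q) (paretoMeasure 1 α) :=
    .of_bound (continuous_bump q).aestronglyMeasurable 1 (ae_of_all _ (abs_bump_le q))
  refine lt_of_le_of_ne (integral_nonneg_of_ae h0) fun hz => ?_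
  have h1 := (integral_eq_zero_iff_of_nonneg_ae h0 hi).1 hz.symm
  have h2 : (paretoMeasure 1 α).real (Set.Ioi 1) = (paretoMeasure 1 α).real (Set.Ioi q) := by
    refine measureReal_congr ?_
    filter_upwards [h1] with r hr
    refine propext ⟨fun h => ?_, fun h => hq.trans h⟩
    by_contra! hle
    exact (bump_pos hq h (not_lt.1 hle)).ne' hr
  rw [pareto_real_Ioi hα le_rfl, pareto_real_Ioi hα hq.le, Real.one_rpow] at h2
  exact (Real.rpow_lt_one_of_one_lt_of_neg hq (by linarith : -α < 0)).ne' h2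

omit [MeasurableSpace Ω] in
-- Just above the level `t` the sparse angle `π(X/t)` is a good substitute for the true angle
-- `X/|X|`.
theorem norm_angle_sub_proj_le (hX : ∀ ω j, 0 ≤ X ω j) {t : ℝ} (ht : 0 < t) {ω : Ω}
    (hω : t < l1 (X ω)) :
    ‖(l1 (X ω))⁻¹ • X ω - proj (t⁻¹ • X ω)‖ ≤ 2 * (l1 (X ω) / t - 1) := by
  have h0 : 0 < l1 (X ω) := ht.trans hω
  have h1 := norm_proj_smul_sub_le (inv_l1_smul_mem (hX ω) h0)
    ((one_le_div ht).2 hω.le)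
  have h2 : (l1 (X ω) / t) • (l1 (X ω))⁻¹ • X ω = t⁻¹ • X ω := by
    rw [smul_smul]; congr 1; field_simp
  rwa [h2, norm_sub_rev] at h1

theorem measurable_angle (hXm : Measurable X) : Measurable fun ω => (l1 (X ω))⁻¹ • X ω :=
  (continuous_l1.measurable.comp hXm).inv.smul hXm

/-- On the shell seen by the bump, true and sparse angle differ by at most `2(q² - 1)`, which costs
`2K(q² - 1)`; the extra `q - 1` is room for convergence of the sparse average. The constant `b` does
not depend on `t`, so it serves all shells at once. -/
theorem angular_bump_bound [IsProbabilityMeasure P] (hXm : Measurable X)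
    (hX : ∀ ω j, 0 ≤ X ω j) {α : ℝ} (hα : 0 < α) {ν : Measure (ℝ × (Fin d → ℝ))}
    [IsProbabilityMeasure ν] (hfst : ν.fst = paretoMeasure 1 α)
    (hlim : CondWeakLimit P X (fun t ω => (l1 (X ω) / t, proj (t⁻¹ • X ω))) ν)
    {h : (Fin d → ℝ) → ℝ} (hc : Continuous h) {B K : ℝ} (hB : ∀ x, |h x| ≤ B) (hK0 : 0 ≤ K)
    (hK : ∀ x y, |h x - h y| ≤ K * ‖x - y‖) {q : ℝ} (hq : 1 < q) :
    ∃ b, |b| ≤ B ∧ ∀ᶠ t : ℝ in atTop,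
      |∫ ω, (h ((l1 (X ω))⁻¹ • X ω) - b) * bump q (l1 (X ω) / t)
        ∂(ProbabilityTheory.cond P {ω | t < l1 (X ω)})| ≤
      (2 * K * (q ^ 2 - 1) + (q - 1)) *
        ∫ ω, bump q (l1 (X ω) / t) ∂(ProbabilityTheory.cond P {ω | t < l1 (X ω)}) := by
  have hpos := hlim.tail_ne_zero
  have hB0 : 0 ≤ B := (abs_nonneg _).trans (hB 0)
  have hbc : Continuous fun p : ℝ × (Fin d → ℝ) => bump q p.1 :=
    (continuous_bump q).comp continuous_fst
  have hhc : Continuous fun p : ℝ × (Fin d → ℝ) => h p.2 := hc.comp continuous_snd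
  have hc0 : 0 < ∫ p, bump q p.1 ∂ν := by
    have := integral_bump_pos hα hq
    rwa [← hfst, Measure.fst, integral_map measurable_fst.aemeasurable
      (continuous_bump q).aestronglyMeasurable] at this
  have hi1 : Integrable (fun p : ℝ × (Fin d → ℝ) => bump q p.1) ν :=
    .of_bound hbc.aestronglyMeasurable 1 (ae_of_all _ fun p => abs_bump_le q _)
  have hb2 : ∀ p : ℝ × (Fin d → ℝ), |h p.2 * bump q p.1| ≤ B := fun p => by
    rw [abs_mul]
    exact (mul_le_of_le_one_right (abs_nonneg _) (abs_bump_le q _)).trans (hB _)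
  have hi2 : Integrable (fun p : ℝ × (Fin d → ℝ) => h p.2 * bump q p.1) ν :=
    .of_bound (hhc.mul hbc).aestronglyMeasurable B (ae_of_all _ hb2)
  have hv0 : ∀ᵐ p ∂ν, 0 ≤ bump q p.1 := by
    have h1 := ae_pareto_one_le α
    rw [← hfst, Measure.fst] at h1
    filter_upwards [ae_of_ae_map measurable_fst.aemeasurable h1] with p hp
    exact bump_nonneg hq (by linarith)
  set c := ∫ p, bump q p.1 ∂ν with hcdef
  -- The bump-weighted mean of `h(Z)`, so that the limit of the centred sparse average is zero.
  set b := (∫ p, h p.2 * bump q p.1 ∂ν) / c with hbdef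
  have hbB : |b| ≤ B := by
    rw [hbdef, abs_div, abs_of_pos hc0, div_le_iff₀ hc0, hcdef, ← integral_const_mul]
    refine (abs_integral_le_integral_abs).trans (integral_mono_ae hi2.abs (hi1.const_mul B) ?_)
    filter_upwards [hv0] with p hp
    rw [abs_mul, abs_of_nonneg hp]
    exact mul_le_mul_of_nonneg_right (hB _) hp
  have hzero : ∫ p, (h p.2 - b) * bump q p.1 ∂ν = 0 := by
    simp only [sub_mul]
    rw [integral_sub hi2 (hi1.const_mul b), integral_const_mul, hbdef, ← hcdef,
      div_mul_cancel₀ _ hc0.ne', sub_self]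
  have hl1 := hlim.tendsto ((hhc.sub continuous_const).mul hbc) (C := B + |b|) fun p => by
    simp only [Pi.mul_apply, Pi.sub_apply]
    rw [abs_mul]
    exact (mul_le_of_le_one_right (abs_nonneg _) (abs_bump_le q _)).trans
      ((abs_sub _ _).trans (by gcongr; exact hB _))
  have hl2 := hlim.tendsto hbc fun p => abs_bump_le q _
  refine ⟨b, hbB, ?_⟩
  have hl3 := (hl2.const_mul (q - 1)).sub hl1.abs
  simp only [Pi.mul_apply, Pi.sub_apply] at hl3
  rw [hzero, abs_zero, sub_zero] at hl3
  filter_upwards [hl3.eventually (lt_mem_nhds (mul_pos (sub_pos.2 hq) hc0)),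
    eventually_gt_atTop 0] with t ht3 ht
  set μ := ProbabilityTheory.cond P {ω | t < l1 (X ω)} with hμ
  have : IsProbabilityMeasure μ := isProbabilityMeasure_cond_tail hpos t
  have hmv : Measurable fun ω => bump q (l1 (X ω) / t) :=
    (continuous_bump q).measurable.comp (measurable_radial hXm t)
  have hmθ : Measurable fun ω => h ((l1 (X ω))⁻¹ • X ω) :=
    hc.measurable.comp (measurable_angle hXm)
  have hmπ : Measurable fun ω => h (proj (t⁻¹ • X ω)) :=
    hc.measurable.comp (measurable_proj.comp (by fun_prop))
  have hiv : Integrable (fun ω => bump q (l1 (X ω) / t)) μ :=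
    .of_bound hmv.aestronglyMeasurable 1 (ae_of_all _ fun p => abs_bump_le q _)
  have hbd : ∀ (a a' : ℝ) (r : ℝ), |a| ≤ B → |a'| ≤ B → ‖(a - a') * bump q r‖ ≤ B + B :=
    fun a a' r ha ha' => by
      rw [norm_mul]
      exact (mul_le_of_le_one_right (abs_nonneg _) (abs_bump_le q _)).trans
        ((abs_sub _ _).trans (add_le_add ha ha'))
  have hi3 : Integrable (fun ω => (h (proj (t⁻¹ • X ω)) - b) * bump q (l1 (X ω) / t)) μ :=
    .of_bound ((hmπ.sub_const b).mul hmv).aestronglyMeasurable (B + B)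
      (ae_of_all _ fun p => hbd _ _ _ (hB _) hbB)
  have hi4 : Integrable (fun ω => (h ((l1 (X ω))⁻¹ • X ω) - h (proj (t⁻¹ • X ω))) *
      bump q (l1 (X ω) / t)) μ :=
    .of_bound ((hmθ.sub hmπ).mul hmv).aestronglyMeasurable (B + B)
      (ae_of_all _ fun p => hbd _ _ _ (hB _) (hB _))
  have hsplit : ∫ ω, (h ((l1 (X ω))⁻¹ • X ω) - b) * bump q (l1 (X ω) / t) ∂μ =
      (∫ ω, (h (proj (t⁻¹ • X ω)) - b) * bump q (l1 (X ω) / t) ∂μ) +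
      ∫ ω, (h ((l1 (X ω))⁻¹ • X ω) - h (proj (t⁻¹ • X ω))) * bump q (l1 (X ω) / t) ∂μ := by
    rw [← integral_add hi3 hi4]
    exact integral_congr_ae (ae_of_all _ fun ω => by ring)
  have hsmall : |∫ ω, (h ((l1 (X ω))⁻¹ • X ω) - h (proj (t⁻¹ • X ω))) *
      bump q (l1 (X ω) / t) ∂μ| ≤ 2 * K * (q ^ 2 - 1) * ∫ ω, bump q (l1 (X ω) / t) ∂μ := by
    rw [← integral_const_mul]
    refine abs_integral_le_integral_abs.trans (integral_mono_ae hi4.abs (hiv.const_mul _) ?_)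
    filter_upwards [ae_cond_mem (measurableSet_l1_gt hXm t)] with ω hω
    have hω' : t < l1 (X ω) := hω
    have hr : 1 < l1 (X ω) / t := (one_lt_div ht).2 hω'
    have hn := bump_nonneg hq (by linarith : 0 ≤ l1 (X ω) / t)
    rw [abs_mul, abs_of_nonneg hn]
    rcases le_or_gt (q ^ 2) (l1 (X ω) / t) with h5 | h5
    · rw [bump_of_ge hq h5]; simp
    · refine mul_le_mul_of_nonneg_right ((hK _ _).trans ?_) hn
      have := norm_angle_sub_proj_le hX ht hω'
      nlinarith
  rw [hsplit, add_mul]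
  refine (abs_add_le _ _).trans ?_
  linarith

/-- Sum the increments over the levels `t`, `tq`, `tq²`, …; what remains at infinity vanishes. -/
theorem abs_le_of_telescope {k W : ℝ → ℝ} {q δ T : ℝ} (hq : 1 < q) (hT : 0 < T)
    (hkW : ∀ t, T ≤ t → |k t - k (t * q)| ≤ δ * (W t - W (t * q)))
    (hk : Tendsto k atTop (𝓝 0)) (hW : Tendsto W atTop (𝓝 0)) {t : ℝ} (ht : T ≤ t) :
    |k t| ≤ δ * W t := by
  have ht0 : 0 < t := hT.trans_le ht
  have hn : ∀ n : ℕ, |k t - k (t * q ^ n)| ≤ δ * (W t - W (t * q ^ n)) := by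
    intro n
    induction n with
    | zero => simp
    | succ n ih =>
      have h1 := hkW (t * q ^ n) (ht.trans (le_mul_of_one_le_right ht0.le (one_le_pow₀ hq.le)))
      rw [mul_assoc, ← pow_succ] at h1
      have h2 := abs_sub_le (k t) (k (t * q ^ n)) (k (t * q ^ (n + 1)))
      linarith
  have hl : Tendsto (fun n : ℕ => t * q ^ n) atTop atTop :=
    (tendsto_pow_atTop_atTop_of_one_lt hq).const_mul_atTop ht0
  have h1 : Tendsto (fun n : ℕ => |k t - k (t * q ^ n)|) atTop (𝓝 |k t - 0|) :=
    (tendsto_const_nhds.sub (hk.comp hl)).abs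
  have h2 : Tendsto (fun n : ℕ => δ * (W t - W (t * q ^ n))) atTop (𝓝 (δ * (W t - 0))) :=
    (tendsto_const_nhds.sub (hW.comp hl)).const_mul δ
  simpa using le_of_tendsto_of_tendsto' h1 h2 hn

/-- The bumps at levels `t qⁿ` telescope to the ramp at level `t`, so the shell estimates add up to
one for the ramp-weighted tail. Replacing the ramp by the indicator of `|X| > t` costs at most `2B`
times the conditional probability of `|X| ≤ tq`. -/
theorem angular_tail_bound [IsProbabilityMeasure P] (hXm : Measurable X)
    (hX : ∀ ω j, 0 ≤ X ω j) {α : ℝ} (hα : 0 < α) {ν : Measure (ℝ × (Fin d → ℝ))}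
    [IsProbabilityMeasure ν] (hfst : ν.fst = paretoMeasure 1 α)
    (hlim : CondWeakLimit P X (fun t ω => (l1 (X ω) / t, proj (t⁻¹ • X ω))) ν)
    {h : (Fin d → ℝ) → ℝ} (hc : Continuous h) {B K : ℝ} (hB : ∀ x, |h x| ≤ B) (hK0 : 0 ≤ K)
    (hK : ∀ x y, |h x - h y| ≤ K * ‖x - y‖) {q : ℝ} (hq : 1 < q) :
    ∃ b, ∀ᶠ t : ℝ in atTop,
      |(∫ ω, h ((l1 (X ω))⁻¹ • X ω) ∂(ProbabilityTheory.cond P {ω | t < l1 (X ω)})) - b| ≤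
      (2 * K * (q ^ 2 - 1) + (q - 1)) +
        (2 * B) * (1 - P.real {ω | t * q < l1 (X ω)} / P.real {ω | t < l1 (X ω)}) := by
  have hpos := hlim.tail_ne_zero
  obtain ⟨b, hbB, hb⟩ := angular_bump_bound hXm hX hα hfst hlim hc hB hK0 hK hq
  refine ⟨b, ?_⟩
  set δ := 2 * K * (q ^ 2 - 1) + (q - 1) with hδ
  have hδ0 : 0 ≤ δ := by
    have : 0 ≤ q ^ 2 - 1 := by nlinarith
    have : 0 ≤ q - 1 := by linarith
    positivity
  set F : ℝ → ℝ := fun t => P.real {ω | t < l1 (X ω)} with hF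
  have hF0 : Tendsto F atTop (𝓝 0) := tendsto_tail hXm
  have hB0 : 0 ≤ B := (abs_nonneg _).trans (hB 0)
  have hmθ : Measurable fun ω => h ((l1 (X ω))⁻¹ • X ω) - b :=
    (hc.measurable.comp (measurable_angle hXm)).sub_const b
  have hmw : ∀ t, Measurable fun ω => rampTo q (l1 (X ω) / t) := fun t =>
    (continuous_rampTo q).measurable.comp (measurable_radial hXm t)
  have hw1 : ∀ r, |rampTo q r| ≤ 1 := fun r => by
    rw [abs_of_nonneg (rampTo_nonneg q r)]; exact rampTo_le_one q r
  have hθB : ∀ ω, |h ((l1 (X ω))⁻¹ • X ω) - b| ≤ 2 * B := fun ω =>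
    (abs_sub _ _).trans (by linarith [hB ((l1 (X ω))⁻¹ • X ω)])
  have hiw : ∀ t, Integrable (fun ω => rampTo q (l1 (X ω) / t)) P := fun t =>
    .of_bound (hmw t).aestronglyMeasurable 1 (ae_of_all _ fun ω => hw1 _)
  have hiθw : ∀ t, Integrable (fun ω => (h ((l1 (X ω))⁻¹ • X ω) - b) *
      rampTo q (l1 (X ω) / t)) P := fun t =>
    .of_bound (hmθ.mul (hmw t)).aestronglyMeasurable (2 * B) (ae_of_all _ fun ω => by
      rw [norm_mul]
      exact (mul_le_of_le_one_right (abs_nonneg _) (hw1 _)).trans (hθB ω))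
  -- Integrals against `P` rather than the conditional laws: they share one normalisation, so shells
  -- at different levels can be added.
  set W : ℝ → ℝ := fun t => ∫ ω, rampTo q (l1 (X ω) / t) ∂P with hW
  set k : ℝ → ℝ := fun t => ∫ ω, (h ((l1 (X ω))⁻¹ • X ω) - b) * rampTo q (l1 (X ω) / t) ∂P
    with hk
  have hW0 : ∀ t, 0 ≤ W t := fun t => integral_nonneg fun ω => rampTo_nonneg q _
  have hind : ∀ t, ∫ ω, Set.indicator {ω | t < l1 (X ω)} (fun _ => (1 : ℝ)) ω ∂P = F t :=
    fun t => by
      rw [integral_indicator_const _ (measurableSet_l1_gt hXm t), smul_eq_mul, mul_one]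
  have hii : ∀ t, Integrable (Set.indicator {ω | t < l1 (X ω)} fun _ => (1 : ℝ)) P := fun t =>
    (integrable_const _).indicator (measurableSet_l1_gt hXm t)
  have hWF : ∀ t, 0 < t → W t ≤ F t := fun t ht => by
    rw [← hind t]
    refine integral_mono (hiw t) (hii t) fun ω => ?_
    by_cases hω : t < l1 (X ω)
    · rw [Set.indicator_of_mem (show ω ∈ {ω | t < l1 (X ω)} from hω)]
      exact rampTo_le_one q _
    · rw [Set.indicator_of_notMem (show ω ∉ {ω | t < l1 (X ω)} from hω)]
      exact (rampTo_of_le hq ((div_le_one ht).2 (not_lt.1 hω))).le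
  have hFW : ∀ t, 0 < t → F (t * q) ≤ W t := fun t ht => by
    rw [← hind (t * q)]
    refine integral_mono (hii _) (hiw t) fun ω => ?_
    by_cases hω : t * q < l1 (X ω)
    · rw [Set.indicator_of_mem (show ω ∈ {ω | t * q < l1 (X ω)} from hω)]
      exact (rampTo_of_ge hq ((le_div_iff₀' ht).2 hω.le)).ge
    · rw [Set.indicator_of_notMem (show ω ∉ {ω | t * q < l1 (X ω)} from hω)]
      exact rampTo_nonneg q _
  have hWlim : Tendsto W atTop (𝓝 0) :=
    squeeze_zero' (Eventually.of_forall hW0) ((eventually_gt_atTop 0).mono hWF) hF0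
  have hklim : Tendsto k atTop (𝓝 0) := by
    refine squeeze_zero_norm (a := fun t => 2 * B * W t) (fun t => ?_)
      (by simpa using hWlim.const_mul (2 * B))
    rw [hW, ← integral_const_mul]
    refine (abs_integral_le_integral_abs).trans (integral_mono (hiθw t).abs
      ((hiw t).const_mul _) fun ω => ?_)
    simp only [abs_mul, abs_of_nonneg (rampTo_nonneg q _)]
    exact mul_le_mul_of_nonneg_right (hθB ω) (rampTo_nonneg q _)
  have hbump0 : ∀ t, 0 < t → ∀ ω, l1 (X ω) ≤ t → bump q (l1 (X ω) / t) = 0 :=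
    fun t ht ω hω => bump_of_le hq ((div_le_one ht).2 hω)
  have hWdiff : ∀ t, W t - W (t * q) = ∫ ω, bump q (l1 (X ω) / t) ∂P := fun t => by
    rw [hW, ← integral_sub (hiw t) (hiw _)]
    simp only [bump, div_div]
  have hkdiff : ∀ t, k t - k (t * q) =
      ∫ ω, (h ((l1 (X ω))⁻¹ • X ω) - b) * bump q (l1 (X ω) / t) ∂P := fun t => by
    rw [hk, ← integral_sub (hiθw t) (hiθw _)]
    simp only [bump, div_div, mul_sub]
  obtain ⟨T, hT⟩ := eventually_atTop.1 hb
  have htel : ∀ t, max T 1 ≤ t → |k t| ≤ δ * W t := fun t ht =>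
    abs_le_of_telescope hq (lt_max_of_lt_right one_pos) (fun s hs => by
      have hs0 : 0 < s := one_pos.trans_le ((le_max_right _ _).trans hs)
      rw [hWdiff, hkdiff, integral_eq_tail_mul hpos (hbump0 s hs0),
        integral_eq_tail_mul hpos (t := s) fun ω hω => by rw [hbump0 s hs0 ω hω, mul_zero],
        abs_mul, abs_of_pos (tail_pos hpos s), mul_left_comm]
      exact mul_le_mul_of_nonneg_left (hT s ((le_max_left _ _).trans hs))
        (tail_pos hpos s).le) hklim hWlim ht
  filter_upwards [eventually_ge_atTop (max T 1)] with t ht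
  have ht0 : 0 < t := one_pos.trans_le ((le_max_right _ _).trans ht)
  have hFt : 0 < F t := tail_pos hpos t
  set μ := ProbabilityTheory.cond P {ω | t < l1 (X ω)} with hμ
  have : IsProbabilityMeasure μ := isProbabilityMeasure_cond_tail hpos t
  have hE : ∀ u : Ω → ℝ, (∀ ω, l1 (X ω) ≤ t → u ω = 0) → ∫ ω, u ω ∂μ = (F t)⁻¹ * ∫ ω, u ω ∂P :=
    fun u hu => by
      rw [integral_eq_tail_mul hpos hu, inv_mul_cancel_left₀ hFt.ne']
  have hr0 : ∀ ω, l1 (X ω) ≤ t → rampTo q (l1 (X ω) / t) = 0 :=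
    fun ω hω => rampTo_of_le hq ((div_le_one ht0).2 hω)
  have hEw := hE _ hr0
  have hEk := hE (fun ω => (h ((l1 (X ω))⁻¹ • X ω) - b) * rampTo q (l1 (X ω) / t))
    fun ω hω => by rw [hr0 ω hω, mul_zero]
  have hjw : Integrable (fun ω => rampTo q (l1 (X ω) / t)) μ :=
    .of_bound (hmw t).aestronglyMeasurable 1 (ae_of_all _ fun ω => hw1 _)
  have hjθ : Integrable (fun ω => h ((l1 (X ω))⁻¹ • X ω) - b) μ :=
    .of_bound hmθ.aestronglyMeasurable (2 * B) (ae_of_all _ hθB)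
  have hjθw : Integrable (fun ω => (h ((l1 (X ω))⁻¹ • X ω) - b) *
      rampTo q (l1 (X ω) / t)) μ :=
    .of_bound (hmθ.mul (hmw t)).aestronglyMeasurable (2 * B) (ae_of_all _ fun ω => by
      rw [norm_mul]
      exact (mul_le_of_le_one_right (abs_nonneg _) (hw1 _)).trans (hθB ω))
  have hlast : |(∫ ω, (h ((l1 (X ω))⁻¹ • X ω) - b) ∂μ) -
      ∫ ω, (h ((l1 (X ω))⁻¹ • X ω) - b) * rampTo q (l1 (X ω) / t) ∂μ| ≤
      2 * B * (1 - ∫ ω, rampTo q (l1 (X ω) / t) ∂μ) := by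
    have h1 : 1 - ∫ ω, rampTo q (l1 (X ω) / t) ∂μ = ∫ ω, (1 - rampTo q (l1 (X ω) / t)) ∂μ := by
      rw [integral_sub (integrable_const _) hjw]; simp
    rw [← integral_sub hjθ hjθw, h1, ← integral_const_mul]
    refine (abs_integral_le_integral_abs).trans (integral_mono (hjθ.sub hjθw).abs
      (((integrable_const _).sub hjw).const_mul _) fun ω => ?_)
    have h2 := rampTo_le_one q (l1 (X ω) / t)
    simp only [← mul_one_sub, abs_mul, abs_of_nonneg (sub_nonneg.2 h2)]
    exact mul_le_mul_of_nonneg_right (hθB ω) (sub_nonneg.2 h2)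
  have hsub : ∫ ω, (h ((l1 (X ω))⁻¹ • X ω) - b) ∂μ = (∫ ω, h ((l1 (X ω))⁻¹ • X ω) ∂μ) - b := by
    have : Integrable (fun ω => h ((l1 (X ω))⁻¹ • X ω)) μ :=
      .of_bound (hc.measurable.comp (measurable_angle hXm)).aestronglyMeasurable B
        (ae_of_all _ fun ω => hB _)
    rw [integral_sub this (integrable_const _)]
    simp
  rw [← hsub]
  have h5 : F (t * q) / F t ≤ ∫ ω, rampTo q (l1 (X ω) / t) ∂μ := by
    rw [hEw, div_eq_inv_mul]
    exact mul_le_mul_of_nonneg_left (hFW t ht0) (by positivity)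
  have h6 : |∫ ω, (h ((l1 (X ω))⁻¹ • X ω) - b) * rampTo q (l1 (X ω) / t) ∂μ| ≤ δ := by
    rw [hEk, abs_mul, abs_of_pos (inv_pos.2 hFt), inv_mul_le_iff₀ hFt, mul_comm]
    exact (htel t ht).trans (mul_le_mul_of_nonneg_left (hWF t ht0) hδ0)
  have h7 : 2 * B * (1 - ∫ ω, rampTo q (l1 (X ω) / t) ∂μ) ≤ 2 * B * (1 - F (t * q) / F t) :=
    mul_le_mul_of_nonneg_left (by linarith) (by linarith)
  have h8 := abs_sub_abs_le_abs_sub (∫ ω, (h ((l1 (X ω))⁻¹ • X ω) - b) ∂μ)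
    (∫ ω, (h ((l1 (X ω))⁻¹ • X ω) - b) * rampTo q (l1 (X ω) / t) ∂μ)
  change |∫ ω, (h ((l1 (X ω))⁻¹ • X ω) - b) ∂μ| ≤ δ + 2 * B * (1 - F (t * q) / F t)
  linarith

/-- The bound of `angular_tail_bound` vanishes as `q ↓ 1`, since the tail ratio tends to `q^(-α)`.
The constant `b` depends on `ε`, so this is a Cauchy property, with no limit identified yet. -/
theorem angular_almost_limit [IsProbabilityMeasure P] (hXm : Measurable X)
    (hX : ∀ ω j, 0 ≤ X ω j) {α : ℝ} (hα : 0 < α) {ν : Measure (ℝ × (Fin d → ℝ))}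
    [IsProbabilityMeasure ν] (hfst : ν.fst = paretoMeasure 1 α)
    (hlim : CondWeakLimit P X (fun t ω => (l1 (X ω) / t, proj (t⁻¹ • X ω))) ν)
    {h : (Fin d → ℝ) → ℝ} (hc : Continuous h) {B K : ℝ} (hB : ∀ x, |h x| ≤ B) (hK0 : 0 ≤ K)
    (hK : ∀ x y, |h x - h y| ≤ K * ‖x - y‖) {ε : ℝ} (hε : 0 < ε) :
    ∃ b, ∀ᶠ t : ℝ in atTop,
      |(∫ ω, h ((l1 (X ω))⁻¹ • X ω) ∂(ProbabilityTheory.cond P {ω | t < l1 (X ω)})) - b| < ε := by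
  have hrad : CondWeakLimit P X (fun t ω => l1 (X ω) / t) (paretoMeasure 1 α) := by
    rw [← hfst]
    exact hlim.comp continuous_fst
  have hcont : ContinuousAt (fun q : ℝ => (2 * K * (q ^ 2 - 1) + (q - 1)) +
      (2 * B) * (1 - q ^ (-α))) 1 := by
    have : ContinuousAt (fun q : ℝ => q ^ (-α)) 1 :=
      Real.continuousAt_rpow_const _ _ (Or.inl one_ne_zero)
    fun_prop
  have h1 : ∀ᶠ q in 𝓝[>] (1 : ℝ), (2 * K * (q ^ 2 - 1) + (q - 1)) +
      (2 * B) * (1 - q ^ (-α)) < ε :=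
    (hcont.tendsto.eventually (gt_mem_nhds (by simpa using hε))).filter_mono nhdsWithin_le_nhds
  obtain ⟨q, hqε, hq⟩ := (h1.and self_mem_nhdsWithin).exists
  obtain ⟨b, hb⟩ := angular_tail_bound hXm hX hα hfst hlim hc hB hK0 hK hq
  refine ⟨b, ?_⟩
  have h2 := (((hrad.tendsto_tail_ratio hXm hα (le_of_lt hq)).const_sub 1).const_mul
    (2 * B)).const_add (2 * K * (q ^ 2 - 1) + (q - 1))
  filter_upwards [hb, h2.eventually (gt_mem_nhds hqε)] with t h3 h4
  exact h3.trans_lt h4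

theorem exists_angular_limit [IsProbabilityMeasure P] (hXm : Measurable X)
    (hX : ∀ ω j, 0 ≤ X ω j) {α : ℝ} (hα : 0 < α) {ν : Measure (ℝ × (Fin d → ℝ))}
    [IsProbabilityMeasure ν] (hfst : ν.fst = paretoMeasure 1 α)
    (hlim : CondWeakLimit P X (fun t ω => (l1 (X ω) / t, proj (t⁻¹ • X ω))) ν) :
    ∃ S : ProbabilityMeasure (Fin d → ℝ), (∀ᵐ θ ∂(S : Measure (Fin d → ℝ)), θ ∈ simplex d) ∧
      CondWeakLimit P X (fun _ ω => (l1 (X ω))⁻¹ • X ω) (S : Measure (Fin d → ℝ)) := by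
  have hpos := hlim.tail_ne_zero
  set law := condLaw hpos fun _ => measurable_angle hXm with hlaw
  -- With the constant sequence of compact sets `simplex d` and mass bound `0` outside, this is
  -- compactness of the set of laws on the simplex.
  have hK := isCompact_setOfPred_probabilityMeasure_mass_eq_compl_isCompact_le
    (tendsto_const_nhds (x := (0 : NNReal)) (f := (atTop : Filter ℕ)))
    (fun _ => isCompact_simplex (d := d)) (Or.inl inferInstance)
  have hmem : ∀ᶠ t in atTop, law t ∈ {μ : ProbabilityMeasure (Fin d → ℝ) |
      ∀ _ : ℕ, μ (simplex d)ᶜ ≤ 0} := by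
    filter_upwards [eventually_ge_atTop 0] with t ht _
    have h0 : (law t : Measure (Fin d → ℝ)) (simplex d)ᶜ = 0 := by
      refine (Measure.map_apply (measurable_angle hXm)
        isClosed_simplex.measurableSet.compl).trans ?_
      refine measure_eq_zero_iff_ae_notMem.2 ?_
      filter_upwards [ae_cond_mem (measurableSet_l1_gt hXm t)] with ω hω h
      exact h (inv_l1_smul_mem (hX ω) (lt_of_le_of_lt ht hω))
    rw [nonpos_iff_eq_zero, ProbabilityMeasure.null_iff_toMeasure_null]
    exact h0
  obtain ⟨S, hSK, hS⟩ := hK (f := map law atTop) (by simpa using hmem)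
  obtain ⟨U, hU, hUS⟩ := mapClusterPt_iff_ultrafilter.1 hS
  refine ⟨S, ?_, ?_⟩
  · have := hSK 0
    rw [nonpos_iff_eq_zero, ProbabilityMeasure.null_iff_toMeasure_null] at this
    exact this
  rw [condWeakLimit_iff hpos fun _ => measurable_angle hXm,
    tendsto_iff_forall_lipschitz_integral_tendsto]
  rintro f ⟨C, hC⟩ ⟨L, hL⟩
  have hB : ∀ x, |f x| ≤ |f 0| + C := fun x => by
    have := hC x 0
    rw [Real.dist_eq] at this
    linarith [abs_sub_abs_le_abs_sub (f x) (f 0)]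
  have hUlim := (ProbabilityMeasure.tendsto_iff_forall_integral_tendsto.1 hUS)
    (BoundedContinuousFunction.ofNormedAddCommGroup f hL.continuous _ hB)
  rw [Metric.tendsto_atTop']
  intro ε hε
  obtain ⟨b, hb⟩ := angular_almost_limit hXm hX hα hfst hlim hL.continuous hB L.2
    (fun x y => by simpa [Real.dist_eq, dist_eq_norm] using hL.dist_le_mul x y) (half_pos hε)
  -- Along the ultrafilter the averages converge to the integral against `S`, which must therefore
  -- lie near the same `b`; this upgrades the cluster point to a limit.
  have hSb : |(∫ x, f x ∂(S : Measure (Fin d → ℝ))) - b| ≤ ε / 2 := by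
    refine le_of_tendsto (hUlim.sub_const b).abs ?_
    filter_upwards [hU hb] with t ht
    rw [← integral_condLaw hpos (fun _ => measurable_angle hXm) t hL.continuous] at ht
    exact ht.le
  obtain ⟨T, hT⟩ := eventually_atTop.1 hb
  refine ⟨T, fun t ht => ?_⟩
  have h1 := hT t ht.le
  rw [← integral_condLaw hpos (fun _ => measurable_angle hXm) t hL.continuous] at h1
  rw [Real.dist_eq]
  have h2 := abs_sub_le (∫ x, f x ∂(law t : Measure (Fin d → ℝ))) b
    (∫ x, f x ∂(S : Measure (Fin d → ℝ)))
  rw [abs_sub_comm b] at h2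
  linarith

/-! ### From sparse regular variation to regular variation -/

theorem cond_measureReal [IsFiniteMeasure P] {A : Set Ω} (hA : MeasurableSet A) (B : Set Ω) :
    (ProbabilityTheory.cond P A).real B = (P.real A)⁻¹ * P.real (A ∩ B) := by
  rw [measureReal_def, cond_apply hA, ENNReal.toReal_mul, ENNReal.toReal_inv]
  rfl

theorem measurable_polar (hXm : Measurable X) (t : ℝ) :
    Measurable fun ω => (l1 (X ω) / t, (l1 (X ω))⁻¹ • X ω) :=
  (measurable_radial hXm t).prodMk (measurable_angle hXm)

/-- An exact factorisation before the limit: restricting to large radius amounts to raising the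
level to `t * max a 1`, where the angular law has the same limit. Asymptotic independence follows.
-/
theorem condLaw_polar_real [IsProbabilityMeasure P] (hXm : Measurable X)
    (hpos : ∀ t, P {ω | t < l1 (X ω)} ≠ 0) {t : ℝ} (ht : 0 < t) (a : ℝ)
    {B : Set (Fin d → ℝ)} (hB : MeasurableSet B) :
    (condLaw hpos (measurable_polar hXm) t : Measure (ℝ × (Fin d → ℝ))).real
        (Set.Ioi a ×ˢ B) =
      P.real {ω | t * max a 1 < l1 (X ω)} / P.real {ω | t < l1 (X ω)} *
        (condLaw hpos (fun _ => measurable_angle hXm) (t * max a 1) :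
          Measure (Fin d → ℝ)).real B := by
  have h1 : (condLaw hpos (measurable_polar hXm) t : Measure (ℝ × (Fin d → ℝ))).real
      (Set.Ioi a ×ˢ B) = (ProbabilityTheory.cond P {ω | t < l1 (X ω)}).real
        ((fun ω => (l1 (X ω) / t, (l1 (X ω))⁻¹ • X ω)) ⁻¹' (Set.Ioi a ×ˢ B)) :=
    map_measureReal_apply (measurable_polar hXm t) (measurableSet_Ioi.prod hB)
  have h2 : (condLaw hpos (fun _ => measurable_angle hXm) (t * max a 1) :
      Measure (Fin d → ℝ)).real B =
        (ProbabilityTheory.cond P {ω | t * max a 1 < l1 (X ω)}).real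
          ((fun ω => (l1 (X ω))⁻¹ • X ω) ⁻¹' B) :=
    map_measureReal_apply (measurable_angle hXm) hB
  rw [h1, h2, cond_measureReal (measurableSet_l1_gt hXm _),
    cond_measureReal (measurableSet_l1_gt hXm _)]
  have h3 : {ω | t < l1 (X ω)} ∩
      (fun ω => (l1 (X ω) / t, (l1 (X ω))⁻¹ • X ω)) ⁻¹' (Set.Ioi a ×ˢ B) =
      {ω | t * max a 1 < l1 (X ω)} ∩ (fun ω => (l1 (X ω))⁻¹ • X ω) ⁻¹' B := by
    ext ω
    change (t < l1 (X ω) ∧ a < l1 (X ω) / t ∧ (l1 (X ω))⁻¹ • X ω ∈ B) ↔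
      (t * max a 1 < l1 (X ω) ∧ (l1 (X ω))⁻¹ • X ω ∈ B)
    rw [← and_assoc, mul_max_of_nonneg _ _ ht.le, max_lt_iff, mul_one, lt_div_iff₀' ht,
      and_comm (a := t < l1 (X ω))]
  rw [h3]
  have := (tail_pos hpos (t * max a 1)).ne'
  field_simp

theorem pareto_real_Ioi_max {α : ℝ} (hα : 0 < α) (a : ℝ) :
    (paretoMeasure 1 α).real (Set.Ioi a) = (max a 1) ^ (-α) := by
  rw [measureReal_def, measure_congr Ioi_ae_eq_Ici, pareto_Ici_max hα,
    ENNReal.toReal_ofReal (by positivity)]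

theorem rV_of_angular_limit [IsProbabilityMeasure P] (hXm : Measurable X) {α : ℝ}
    (hα : 0 < α) (hrad : CondWeakLimit P X (fun t ω => l1 (X ω) / t) (paretoMeasure 1 α))
    {S : ProbabilityMeasure (Fin d → ℝ)}
    (hSs : ∀ᵐ θ ∂(S : Measure (Fin d → ℝ)), θ ∈ simplex d)
    (hang : CondWeakLimit P X (fun _ ω => (l1 (X ω))⁻¹ • X ω) (S : Measure (Fin d → ℝ))) :
    RV P X α S := by
  have := isProbabilityMeasure_paretoMeasure zero_lt_one hα
  have hpos := hrad.tail_ne_zero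
  refine ⟨hα, inferInstance, hSs, ?_⟩
  set M : ProbabilityMeasure (ℝ × (Fin d → ℝ)) := ⟨(paretoMeasure 1 α).prod S, inferInstance⟩
    with hM
  change CondWeakLimit P X _ (M : Measure (ℝ × (Fin d → ℝ)))
  rw [condWeakLimit_iff hpos (measurable_polar hXm)]
  have hlaw := (condWeakLimit_iff hpos fun _ => measurable_angle hXm).1 hang
  have hIoi : ∀ (a : ℝ) (B : Set (Fin d → ℝ)), MeasurableSet B →
      (S : Measure (Fin d → ℝ)) (frontier B) = 0 →
      Tendsto (fun t => (condLaw hpos (measurable_polar hXm) t :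
        Measure (ℝ × (Fin d → ℝ))).real (Set.Ioi a ×ˢ B)) atTop
        (𝓝 ((M : Measure (ℝ × (Fin d → ℝ))).real (Set.Ioi a ×ˢ B))) := by
    intro a B hB hfr
    have h1 : (M : Measure (ℝ × (Fin d → ℝ))).real (Set.Ioi a ×ˢ B) =
        (max a 1) ^ (-α) * (S : Measure (Fin d → ℝ)).real B := by
      rw [← pareto_real_Ioi_max hα]
      exact measureReal_prod_prod _ _
    rw [h1]
    have h2 := (ENNReal.tendsto_toReal (measure_ne_top _ _)).comp
      (ProbabilityMeasure.tendsto_measure_of_null_frontier_of_tendsto' hlaw hfr)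
    have h3 := h2.comp (tendsto_id.atTop_mul_const
      (lt_max_of_lt_right one_pos : (0 : ℝ) < max a 1))
    refine ((hrad.tendsto_tail_ratio hXm hα (le_max_right a 1)).mul h3).congr' ?_
    filter_upwards [eventually_gt_atTop 0] with t ht
    rw [condLaw_polar_real hXm hpos ht a hB]
    rfl
  -- Convergence is tested on a π-system of rectangles containing small neighbourhoods of every
  -- point. Half-open intervals make it stable under intersection, and their measures are
  -- differences of those from `hIoi`; balls around `θ` of suitable radius have `S`-null frontier.
  refine IsPiSystem.tendsto_probabilityMeasure_of_tendsto_of_mem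
    (S := {s | ∃ (a b : ℝ) (B : Set (Fin d → ℝ)), MeasurableSet B ∧
      (S : Measure (Fin d → ℝ)) (frontier B) = 0 ∧ s = Set.Ioc a b ×ˢ B}) ?_ ?_ ?_ ?_
  · rintro _ ⟨a, b, B, hB, hfr, rfl⟩ _ ⟨a', b', B', hB', hfr', rfl⟩ _
    refine ⟨_, _, B ∩ B', hB.inter hB', ?_, by rw [Set.prod_inter_prod, Set.Ioc_inter_Ioc]⟩
    refine measure_mono_null (frontier_inter_subset B B') (measure_union_null ?_ ?_)
    · exact measure_mono_null Set.inter_subset_left hfr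
    · exact measure_mono_null Set.inter_subset_right hfr'
  · rintro _ ⟨a, b, B, hB, -, rfl⟩
    exact measurableSet_Ioc.prod hB
  · rintro u hu ⟨r, θ⟩ hx
    obtain ⟨ε, hε, hball⟩ := Metric.isOpen_iff.1 hu _ hx
    obtain ⟨δ, hδ, hfr⟩ := exists_null_frontier_thickening (S : Measure (Fin d → ℝ)) {θ} hε
    rw [Metric.thickening_singleton] at hfr
    refine ⟨Set.Ioc (r - ε / 2) (r + ε / 2) ×ˢ Metric.ball θ δ,
      ⟨_, _, _, Metric.isOpen_ball.measurableSet, hfr, rfl⟩,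
      prod_mem_nhds (Ioc_mem_nhds (by linarith) (by linarith)) (Metric.ball_mem_nhds _ hδ.1), ?_⟩
    refine Set.Subset.trans ?_ hball
    rw [← ball_prod_same]
    refine Set.prod_mono (fun s hs => ?_) (Metric.ball_subset_ball hδ.2.le)
    rw [Metric.mem_ball, Real.dist_eq, abs_lt]
    constructor <;> linarith [hs.1, hs.2]
  · rintro _ ⟨a, b, B, hB, hfr, rfl⟩
    rw [← NNReal.tendsto_coe]
    rcases le_or_gt b a with hab | hab
    · simp [Set.Ioc_eq_empty_of_le hab]
    have hdiff : ∀ μ : ProbabilityMeasure (ℝ × (Fin d → ℝ)),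
        ((μ (Set.Ioc a b ×ˢ B) : NNReal) : ℝ) =
          (μ : Measure (ℝ × (Fin d → ℝ))).real (Set.Ioi a ×ˢ B) -
            (μ : Measure (ℝ × (Fin d → ℝ))).real (Set.Ioi b ×ˢ B) := fun μ => by
      rw [← measureReal_sdiff (Set.prod_mono (Set.Ioi_subset_Ioi hab.le) le_rfl)
        (measurableSet_Ioi.prod hB)]
      have : Set.Ioc a b ×ˢ B = Set.Ioi a ×ˢ B \ Set.Ioi b ×ˢ B := by
        ext p
        simp only [Set.mem_prod, Set.mem_Ioc, Set.mem_sdiff, Set.mem_Ioi, ← not_lt]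
        tauto
      rw [this]
      rfl
    simp only [hdiff]
    exact (hIoi a B hB hfr).sub (hIoi b B hB hfr)

theorem SRV.exists_rV [IsProbabilityMeasure P] (hXm : Measurable X)
    (hX : ∀ ω j, 0 ≤ X ω j) {α : ℝ} {ζ : Measure (Fin d → ℝ)} (h : SRV P X α ζ) :
    ∃ S : Measure (Fin d → ℝ), RV P X α S ∧ ζ = projLaw α S := by
  obtain ⟨hα, ν, ⟨hν, -, -, hlim⟩, hfst, hsnd⟩ := h
  obtain ⟨S, hSs, hang⟩ := exists_angular_limit hXm hX hα hfst hlim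
  have hrad : CondWeakLimit P X (fun t ω => l1 (X ω) / t) (paretoMeasure 1 α) := by
    rw [← hfst]
    exact hlim.comp continuous_fst
  have hRV := rV_of_angular_limit hXm hα hrad hSs hang
  obtain ⟨-, ν', ⟨hν', -, -, hlim'⟩, -, hsnd'⟩ := hRV.sRV hXm
  exact ⟨S, hRV, by rw [← hsnd, ← hsnd', hlim.unique hlim']⟩

end

/-! ### The law of the spectral vector in terms of the limit -/

theorem mem_A_extend_iff {d : ℕ} {β : Finset (Fin d)} {y : β → ℝ} {u : Fin d → ℝ}
    (hu : u ∈ simplex d) : u ∈ A (extend β y) ↔ ∀ j : β, y j ≤ u j := by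
  constructor
  · intro h j
    have := h.2 j
    rwa [extend, dif_pos j.2] at this
  · refine fun h => ⟨hu, fun j => ?_⟩
    rw [extend]
    split_ifs with hj
    · exact h ⟨j, hj⟩
    · exact hu.1 j

theorem measurableSet_forall {E ι : Type*} [MeasurableSpace E] [Countable ι]
    {p : ι → E → Prop} (h : ∀ j, MeasurableSet {x | p j x}) : MeasurableSet {x | ∀ j, p j x} := by
  simp only [Set.ofPred_forall]
  exact MeasurableSet.iInter h

theorem measurableSet_A {d : ℕ} (x : Fin d → ℝ) : MeasurableSet (A x) := by
  exact isClosed_simplex.measurableSet.inter (measurableSet_forall fun j =>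
    measurableSet_le measurable_const (measurable_pi_apply j))

/-- The role of `φ_γ`: because `z` has mass one, the dilation `q` acts on the face coordinates
through `φ_γ(z)` and a shift independent of `z`. Off `γ` the mass of `z_j` itself counts in the
complement, whence the factor `|γ| + 1` in the next lemma. -/
theorem faceCoord_smul_of_mem {d : ℕ} {γ : Finset (Fin d)} (hγ : γ.Nonempty) {z : Fin d → ℝ}
    (hz : z ∈ simplex d) (q : ℝ) {j : Fin d} (hj : j ∈ γ) :
    faceCoord γ (q • z) j = q * phi γ z j - (q - 1) / γ.card := by
  have hc : (γ.card : ℝ) ≠ 0 := by exact_mod_cast hγ.card_ne_zero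
  have h1 := Finset.sum_add_sum_compl γ z
  rw [hz.2] at h1
  simp only [faceCoord, phi, if_pos hj, Pi.smul_apply, smul_eq_mul, ← Finset.mul_sum]
  rw [← eq_sub_iff_add_eq'] at h1
  rw [h1]
  field_simp
  ring

theorem faceCoord_smul_of_notMem {d : ℕ} {γ : Finset (Fin d)} (hγ : γ.Nonempty) {z : Fin d → ℝ}
    (hz : z ∈ simplex d) (q : ℝ) {j : Fin d} (hj : j ∉ γ) :
    γ.card * faceCoord γ (q • z) j = (γ.card + 1) * (q * phi γ z j) - (q - 1) := by
  have hc : (γ.card : ℝ) ≠ 0 := by exact_mod_cast hγ.card_ne_zero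
  have hc' : (γ.card : ℝ) + 1 ≠ 0 := by positivity
  have h1 := Finset.sum_add_sum_compl γ z
  have h2 := Finset.add_sum_erase γᶜ z (Finset.mem_compl.2 hj)
  rw [hz.2] at h1
  simp only [faceCoord, phi, if_neg hj, Pi.smul_apply, smul_eq_mul, ← Finset.mul_sum]
  rw [← eq_sub_iff_add_eq'] at h2
  rw [← eq_sub_iff_add_eq] at h1
  rw [h2, h1]
  field_simp
  ring

/-- The point at which `H_{β,γ}` is evaluated to describe the law of `π(Z / (1 - s))`. -/
def pathH {d : ℕ} {β : Finset (Fin d)} (γ : Finset (Fin d)) (y : β → ℝ) (s : ℝ) :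
    (β → ℝ) × ℝ × ℝ :=
  (fun j => y j + s * (1 / γ.card - y j), s * (1 / γ.card), s * (1 / (γ.card + 1)))

/-- Multiplying the face inequalities by `1 - s` makes all thresholds for `φ_γ(z)` affine in `s`;
this is why the dilation is written `1/(1-s)`. On `β` positivity follows from the lower bound `y`.
-/
theorem proj_smul_mem_face_iff {d : ℕ} {β γ : Finset (Fin d)} (hβ : β.Nonempty) (hβγ : β ⊆ γ)
    {y : β → ℝ} (hy : ∀ j, 0 < y j) {z : Fin d → ℝ} (hz : z ∈ simplex d) {s : ℝ}
    (hs1 : s < 1) :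
    ((∀ j : β, y j ≤ proj ((1 - s)⁻¹ • z) j) ∧ (∀ j ∈ γ, 0 < proj ((1 - s)⁻¹ • z) j) ∧
      ∀ j, j ∉ γ → proj ((1 - s)⁻¹ • z) j = 0) ↔
    (∀ j : β, (pathH γ y s).1 j ≤ phi γ z j) ∧ (∀ j ∈ γ \ β, (pathH γ y s).2.1 < phi γ z j) ∧
      ∀ j ∈ γᶜ, phi γ z j ≤ (pathH γ y s).2.2 := by
  have hγ := hβ.mono hβγ
  have hc : 0 < (γ.card : ℝ) := by exact_mod_cast hγ.card_pos
  have hs : 0 < 1 - s := by linarith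
  have hq : 0 < (1 - s)⁻¹ := inv_pos.2 hs
  have hin : ∀ j ∈ γ, ∀ c : ℝ, (1 - s) * (faceCoord γ ((1 - s)⁻¹ • z) j - c) =
      phi γ z j - (c + s * (1 / γ.card - c)) := fun j hj c => by
    rw [faceCoord_smul_of_mem hγ hz _ hj]
    field_simp
    ring
  have hle : ∀ j ∈ γ, ∀ c, c ≤ faceCoord γ ((1 - s)⁻¹ • z) j ↔
      c + s * (1 / γ.card - c) ≤ phi γ z j := fun j hj c => by
    rw [← sub_nonneg, ← sub_nonneg (b := c + _), ← hin j hj, mul_nonneg_iff_of_pos_left hs]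
  have hlt : ∀ j ∈ γ, 0 < faceCoord γ ((1 - s)⁻¹ • z) j ↔
      s * (1 / γ.card) < phi γ z j := fun j hj => by
    have := hin j hj 0
    rw [sub_zero, sub_zero, zero_add] at this
    rw [← sub_pos (b := s * _), ← this, mul_pos_iff_of_pos_left hs]
  have hout : ∀ j, j ∉ γ → (faceCoord γ ((1 - s)⁻¹ • z) j ≤ 0 ↔
      phi γ z j ≤ s * (1 / (γ.card + 1))) := fun j hj => by
    have h1 := faceCoord_smul_of_notMem hγ hz (1 - s)⁻¹ hj
    have h2 : (1 - s) * (γ.card * faceCoord γ ((1 - s)⁻¹ • z) j) =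
        (γ.card + 1) * (phi γ z j - s * (1 / (γ.card + 1))) := by
      rw [h1]; field_simp; ring
    have h3 : 0 < faceCoord γ ((1 - s)⁻¹ • z) j ↔ 0 < phi γ z j - s * (1 / (γ.card + 1)) := by
      calc 0 < faceCoord γ ((1 - s)⁻¹ • z) j ↔
            0 < (1 - s) * (γ.card * faceCoord γ ((1 - s)⁻¹ • z) j) := by
            rw [mul_pos_iff_of_pos_left hs, mul_pos_iff_of_pos_left hc]
        _ ↔ _ := by rw [h2, mul_pos_iff_of_pos_left (by positivity)]
    rw [← not_lt, h3, sub_pos, not_lt]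
  rw [support_proj_iff hγ]
  simp only [pathH]
  constructor
  · rintro ⟨h1, h2, h3⟩
    have h4 := (support_proj_iff hγ _).2 ⟨h2, h3⟩
    refine ⟨fun j => ?_, fun j hj => (hlt j (Finset.mem_sdiff.1 hj).1).1
      (h2 j (Finset.mem_sdiff.1 hj).1), fun j hj => (hout j (Finset.mem_compl.1 hj)).1
      (h3 j (Finset.mem_compl.1 hj))⟩
    rw [← hle j (hβγ j.2), ← proj_apply_of_support hγ h4.1 h4.2 (hβγ j.2)]
    exact h1 j
  · rintro ⟨h1, h2, h3⟩
    have h5 : ∀ j ∈ γ, 0 < faceCoord γ ((1 - s)⁻¹ • z) j := fun j hj => by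
      by_cases hjβ : j ∈ β
      · exact (hy ⟨j, hjβ⟩).trans_le ((hle j hj _).2 (h1 ⟨j, hjβ⟩))
      · exact (hlt j hj).2 (h2 j (Finset.mem_sdiff.2 ⟨hj, hjβ⟩))
    have h6 : ∀ j, j ∉ γ → faceCoord γ ((1 - s)⁻¹ • z) j ≤ 0 := fun j hj =>
      (hout j hj).2 (h3 j (Finset.mem_compl.2 hj))
    have h4 := (support_proj_iff hγ _).2 ⟨h5, h6⟩
    refine ⟨fun j => ?_, h5, h6⟩
    rw [proj_apply_of_support hγ h4.1 h4.2 (hβγ j.2), hle j (hβγ j.2)]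
    exact h1 j

/-- The law of `π(Z / (1 - s))` in terms of the functions `H_{β,γ}`. -/
theorem real_proj_smul_mem_A {d : ℕ} {ζ : Measure (Fin d → ℝ)} [IsProbabilityMeasure ζ]
    (hζ : ∀ᵐ z ∂ζ, z ∈ simplex d) {β : Finset (Fin d)} (hβ : β.Nonempty) {y : β → ℝ}
    (hy : ∀ j, 0 < y j) {s : ℝ} (hs1 : s < 1) :
    ζ.real {z | proj ((1 - s)⁻¹ • z) ∈ A (extend β y)} =
      ∑ γ : Finset (Fin d) with β ⊆ γ, H ζ β γ (pathH γ y s) := by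
  have hd := ne_zero_of_ae_mem_simplex hζ
  -- The event is partitioned by the support `γ` of the projection, which contains `β` because `y >
  -- 0`.
  set E : Finset (Fin d) → Set (Fin d → ℝ) := fun γ =>
    {z | (∀ j : β, y j ≤ proj ((1 - s)⁻¹ • z) j) ∧ (∀ j ∈ γ, 0 < proj ((1 - s)⁻¹ • z) j) ∧
      ∀ j, j ∉ γ → proj ((1 - s)⁻¹ • z) j = 0} with hE
  have hm : ∀ j, Measurable fun z : Fin d → ℝ => proj ((1 - s)⁻¹ • z) j := fun j =>
    (measurable_pi_apply j).comp (measurable_proj.comp (by fun_prop))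
  have hEm : ∀ γ, MeasurableSet (E γ) := fun γ => by
    refine MeasurableSet.inter ?_ (MeasurableSet.inter ?_ ?_)
    · exact measurableSet_forall fun j : β => measurableSet_le measurable_const (hm j)
    · exact measurableSet_forall_mem γ fun j _ => measurableSet_lt measurable_const (hm j)
    · simp only [← Finset.mem_compl]
      exact measurableSet_forall_mem γᶜ fun j _ => measurableSet_eq_fun (hm j) measurable_const
  have hdisj : (↑(Finset.univ.filter fun γ : Finset (Fin d) => β ⊆ γ) :
      Set (Finset (Fin d))).PairwiseDisjoint E := by
    intro γ _ γ' _ hne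
    refine Set.disjoint_left.2 fun z hz hz' => hne ?_
    have h1 : ∀ j, j ∈ γ ↔ 0 < proj ((1 - s)⁻¹ • z) j := fun j =>
      ⟨hz.2.1 j, fun h => by_contra fun hj => h.ne' (hz.2.2 j hj)⟩
    have h2 : ∀ j, j ∈ γ' ↔ 0 < proj ((1 - s)⁻¹ • z) j := fun j =>
      ⟨hz'.2.1 j, fun h => by_contra fun hj => h.ne' (hz'.2.2 j hj)⟩
    ext j
    rw [h1, h2]
  have hU : {z | proj ((1 - s)⁻¹ • z) ∈ A (extend β y)} =
      ⋃ γ ∈ Finset.univ.filter fun γ : Finset (Fin d) => β ⊆ γ, E γ := by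
    ext z
    simp only [Set.mem_iUnion, Finset.mem_filter, Finset.mem_univ, true_and, exists_prop]
    refine (mem_A_extend_iff (proj_mem hd _)).trans ⟨fun h => ?_, fun ⟨γ, _, h⟩ => h.1⟩
    refine ⟨Finset.univ.filter fun j => 0 < proj ((1 - s)⁻¹ • z) j, fun j hj => ?_, h,
      fun j hj => (Finset.mem_filter.1 hj).2, fun j hj => ?_⟩
    · exact Finset.mem_filter.2 ⟨Finset.mem_univ _, (hy ⟨j, hj⟩).trans_le (h ⟨j, hj⟩)⟩
    · refine le_antisymm (not_lt.1 fun h' => hj ?_) ((proj_mem hd _).1 j)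
      exact Finset.mem_filter.2 ⟨Finset.mem_univ _, h'⟩
  rw [hU, measureReal_biUnion_finset hdisj fun γ _ => hEm γ]
  refine Finset.sum_congr rfl fun γ hγ => measureReal_congr ?_
  filter_upwards [hζ] with z hz
  exact propext (proj_smul_mem_face_iff hβ (Finset.mem_filter.1 hγ).2 hy hz hs1)

/-! ### Truncating the radius just above one -/

theorem ae_projLaw_mem {d : ℕ} (hd : d ≠ 0) (α : ℝ) (S : Measure (Fin d → ℝ)) :
    ∀ᵐ z ∂projLaw α S, z ∈ simplex d := by
  exact (ae_map_iff (p := fun z => z ∈ simplex d) measurable_proj_smul.aemeasurable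
    isClosed_simplex.measurableSet).2 (ae_of_all _ fun p => proj_mem hd _)

/-- The part of the law of `π(YΘ)` on which `Y ≤ q`. -/
theorem real_le_proj_mem {d : ℕ} {α : ℝ} (hα : 0 < α) (S : Measure (Fin d → ℝ))
    [IsProbabilityMeasure S] {q : ℝ} (hq : 1 ≤ q) {B : Set (Fin d → ℝ)} (hB : MeasurableSet B) :
    ((paretoMeasure 1 α).prod S).real {p | p.1 ≤ q ∧ proj (p.1 • p.2) ∈ B} =
      (projLaw α S).real B - q ^ (-α) * (projLaw α S).real {z | proj (q • z) ∈ B} := by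
  have := isProbabilityMeasure_paretoMeasure zero_lt_one hα
  have hm : MeasurableSet {p : ℝ × (Fin d → ℝ) | proj (p.1 • p.2) ∈ B} :=
    measurable_proj_smul hB
  have hq0 : 0 < q := by linarith
  have hmq : MeasurableSet {z : Fin d → ℝ | proj (q • z) ∈ B} :=
    (measurable_proj.comp (by fun_prop : Measurable fun z : Fin d → ℝ => q • z)) hB
  -- Beyond `q` the radius is again Pareto after division by `q`, and `proj_smul_proj` moves the
  -- factor `q` outside the inner projection.
  have h1 : ((paretoMeasure 1 α).prod S).restrict (Set.Ioi q ×ˢ Set.univ) =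
      ENNReal.ofReal (q ^ (-α)) •
        ((paretoMeasure 1 α).prod S).map (Prod.map (fun r => q * r) id) := by
    rw [← Measure.prod_restrict, Measure.restrict_univ, pareto_restrict_Ioi hα hq,
      Measure.prod_smul_left, ← Measure.map_prod_map _ _ (by fun_prop) measurable_id,
      Measure.map_id]
  have h2 : ((paretoMeasure 1 α).prod S).real
      ({p | proj (p.1 • p.2) ∈ B} ∩ (Set.Ioi q ×ˢ Set.univ)) =
      q ^ (-α) * (projLaw α S).real {z | proj (q • z) ∈ B} := by
    rw [← measureReal_restrict_apply hm, h1, measureReal_ennreal_smul_apply,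
      ENNReal.toReal_ofReal (by positivity),
      map_measureReal_apply (by fun_prop) hm, projLaw,
      map_measureReal_apply measurable_proj_smul hmq]
    congr 2
    ext p
    change proj ((q * p.1) • p.2) ∈ B ↔ proj (q • proj (p.1 • p.2)) ∈ B
    rw [proj_smul_proj hq, smul_smul]
  have h3 := measureReal_inter_add_sdiff (μ := (paretoMeasure 1 α).prod S)
    (s := {p : ℝ × (Fin d → ℝ) | proj (p.1 • p.2) ∈ B})
    ((measurableSet_Ioi (a := q)).prod MeasurableSet.univ)
  rw [h2] at h3
  rw [projLaw, map_measureReal_apply measurable_proj_smul hB]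
  rw [projLaw] at h3
  have h4 : {p : ℝ × (Fin d → ℝ) | p.1 ≤ q ∧ proj (p.1 • p.2) ∈ B} =
      {p : ℝ × (Fin d → ℝ) | proj (p.1 • p.2) ∈ B} \ (Set.Ioi q ×ˢ Set.univ) := by
    ext p
    change p.1 ≤ q ∧ _ ↔ _ ∧ ¬ (q < p.1 ∧ True)
    rw [and_true, not_lt, and_comm]
    rfl
  rw [h4]
  change _ + _ = ((paretoMeasure 1 α).prod S).real
    ((fun p : ℝ × (Fin d → ℝ) => proj (p.1 • p.2)) ⁻¹' B) at h3
  linarith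

/-- Each coordinate has at most countably many atoms under `S`, a Lebesgue-null set of levels. -/
theorem ae_no_level_mass {d : ℕ} (S : Measure (Fin d → ℝ)) [IsProbabilityMeasure S]
    (β : Finset (Fin d)) :
    ∀ᵐ y ∂(volume : Measure (β → ℝ)), ∀ j : β, ∀ᵐ θ ∂S, θ j ≠ y j := by
  refine ae_all_iff.2 fun j => ?_
  have h1 : Set.Countable {t : ℝ | 0 < S {θ | θ j = t}} :=
    Measure.countable_meas_level_set_pos (measurable_pi_apply (j : Fin d))
  have h2 : ∀ᵐ t ∂(volume : Measure ℝ), ∀ᵐ θ ∂S, θ j ≠ t := by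
    filter_upwards [h1.ae_notMem volume] with t ht
    have h3 : ¬ 0 < S {θ | θ j = t} := ht
    rw [ae_iff]
    simpa using h3
  exact (Measure.quasiMeasurePreserving_eval (fun _ : β => (volume : Measure ℝ)) j).ae h2

theorem tendsto_real_orthant {d : ℕ} {S : Measure (Fin d → ℝ)} [IsProbabilityMeasure S]
    (hSs : ∀ᵐ θ ∂S, θ ∈ simplex d) {β : Finset (Fin d)} {y : β → ℝ}
    (hy : ∀ j : β, ∀ᵐ θ ∂S, θ j ≠ y j) :
    Tendsto (fun ε : ℝ => S.real {θ | ∀ j : β, y j + ε ≤ θ j}) (𝓝 0)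
      (𝓝 (S.real (A (extend β y)))) := by
  have hm : ∀ ε : ℝ, MeasurableSet {θ : Fin d → ℝ | ∀ j : β, y j + ε ≤ θ j} := fun ε =>
    measurableSet_forall fun j => measurableSet_le measurable_const (measurable_pi_apply _)
  refine (ENNReal.tendsto_toReal (measure_ne_top _ _)).comp
    (tendsto_measure_of_ae_tendsto_indicator_of_isFiniteMeasure _ (measurableSet_A _) hm ?_)
  filter_upwards [hSs, ae_all_iff.2 hy] with θ hθ hne
  have h1 : ∀ j : β, ∀ᶠ ε : ℝ in 𝓝 0, (y j + ε ≤ θ j ↔ y j ≤ θ j) := fun j => by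
    rcases lt_or_gt_of_ne (hne j) with h | h
    · filter_upwards [lt_mem_nhds (show θ j - y j < 0 by linarith)] with ε hε
      constructor <;> intro <;> linarith
    · filter_upwards [gt_mem_nhds (show 0 < θ j - y j by linarith)] with ε hε
      constructor <;> intro <;> linarith
  filter_upwards [eventually_all.2 h1] with ε hε
  rw [mem_A_extend_iff hθ]
  exact forall_congr' hε

/-- For `Y ≤ q` the projection stays within `2(q-1)` of `Θ`, so the event is squeezed between
orthant events shifted by `±2(q-1)`. By independence each of these has probability `1 - q^(-α)`
times its `S`-mass. -/
theorem tendsto_truncated_ratio {d : ℕ} {α : ℝ} (hα : 0 < α) {S : Measure (Fin d → ℝ)}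
    [IsProbabilityMeasure S] (hSs : ∀ᵐ θ ∂S, θ ∈ simplex d) {β : Finset (Fin d)} {y : β → ℝ}
    (hy : ∀ j : β, ∀ᵐ θ ∂S, θ j ≠ y j) :
    Tendsto (fun q : ℝ => ((paretoMeasure 1 α).prod S).real
        {p | p.1 ≤ q ∧ proj (p.1 • p.2) ∈ A (extend β y)} / (1 - q ^ (-α))) (𝓝[>] 1)
      (𝓝 (S.real (A (extend β y)))) := by
  have := isProbabilityMeasure_paretoMeasure zero_lt_one hα
  have hd := ne_zero_of_ae_mem_simplex hSs
  have hcont : Tendsto (fun q : ℝ => 2 * (q - 1)) (𝓝[>] 1) (𝓝 0) := by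
    have : ContinuousAt (fun q : ℝ => 2 * (q - 1)) 1 := by fun_prop
    simpa using this.tendsto.mono_left nhdsWithin_le_nhds
  have hlim := tendsto_real_orthant hSs hy
  have hae : ∀ᵐ p ∂(paretoMeasure 1 α).prod S, 1 ≤ p.1 ∧ p.2 ∈ simplex d :=
    (Measure.quasiMeasurePreserving_fst.ae (ae_pareto_one_le α)).and
      (Measure.quasiMeasurePreserving_snd.ae hSs)
  have hprod : ∀ q : ℝ, 1 ≤ q → ∀ B : Set (Fin d → ℝ),
      ((paretoMeasure 1 α).prod S).real (Set.Iic q ×ˢ B) = (1 - q ^ (-α)) * S.real B := by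
    intro q hq B
    rw [measureReal_prod_prod, ← pareto_real_Ioi hα hq, ← Set.compl_Ioi,
      probReal_compl_eq_one_sub measurableSet_Ioi]
  have hbound : ∀ p : ℝ × (Fin d → ℝ), 1 ≤ p.1 ∧ p.2 ∈ simplex d → ∀ j,
      |proj (p.1 • p.2) j - p.2 j| ≤ 2 * (p.1 - 1) := fun p hp j =>
    (norm_le_pi_norm (proj (p.1 • p.2) - p.2) j).trans (norm_proj_smul_sub_le hp.2 hp.1)
  refine tendsto_of_tendsto_of_tendsto_of_le_of_le' (hlim.comp hcont)
    (hlim.comp (by simpa using hcont.neg)) ?_ ?_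
  · filter_upwards [self_mem_nhdsWithin] with q hq
    have hq1 : (1 : ℝ) < q := hq
    have hpos : 0 < 1 - q ^ (-α) :=
      sub_pos.2 (Real.rpow_lt_one_of_one_lt_of_neg hq1 (by linarith))
    rw [le_div_iff₀' hpos, Function.comp_apply, ← hprod q hq1.le]
    refine ENNReal.toReal_mono (measure_ne_top _ _) (measure_mono_ae ?_)
    filter_upwards [hae] with p hp hpq
    have hpq' : p.1 ≤ q ∧ ∀ j : β, y j + 2 * (q - 1) ≤ p.2 j := hpq
    refine ⟨hpq'.1, (mem_A_extend_iff (proj_mem hd _)).2 fun j => ?_⟩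
    have h1 := abs_le.1 (hbound p hp j)
    linarith [hpq'.1, hpq'.2 j]
  · filter_upwards [self_mem_nhdsWithin] with q hq
    have hq1 : (1 : ℝ) < q := hq
    have hpos : 0 < 1 - q ^ (-α) :=
      sub_pos.2 (Real.rpow_lt_one_of_one_lt_of_neg hq1 (by linarith))
    rw [div_le_iff₀' hpos, Function.comp_apply, ← hprod q hq1.le]
    refine ENNReal.toReal_mono (measure_ne_top _ _) (measure_mono_ae ?_)
    filter_upwards [hae] with p hp hpq
    have hpq' : p.1 ≤ q ∧ proj (p.1 • p.2) ∈ A (extend β y) := hpq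
    refine ⟨hpq'.1, fun j => ?_⟩
    have h1 := abs_le.1 (hbound p hp j)
    have h2 := (mem_A_extend_iff (proj_mem hd _)).1 hpq'.2 j
    linarith [hpq'.1]

/-- The first component is a convex combination of `y` and the constant vector `1/|γ|`, whose mass
on `β` is `|β|/|γ| ≤ 1`. Staying in the domain is what permits the use of one-sided differentials.
-/
theorem pathH_mem_domH {d : ℕ} {β γ : Finset (Fin d)} (hβ : β.Nonempty) (hβγ : β ⊆ γ)
    {y : β → ℝ} (hy : y ∈ openFace β) {s : ℝ} (hs : s ∈ Set.Icc (0 : ℝ) 1) :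
    pathH γ y s ∈ domH β := by
  have hc : 1 ≤ (γ.card : ℝ) := by exact_mod_cast (hβ.mono hβγ).card_pos
  have hcβ : (β.card : ℝ) ≤ γ.card := by exact_mod_cast Finset.card_le_card hβγ
  have hs0 := hs.1
  have hs1 := hs.2
  have h1 : (0 : ℝ) ≤ 1 / γ.card := by positivity
  have h2 : 1 / (γ.card : ℝ) ≤ 1 := (div_le_one (by linarith)).2 hc
  have h3 : (0 : ℝ) ≤ 1 / (γ.card + 1) := by positivity
  have h4 : 1 / ((γ.card : ℝ) + 1) ≤ 1 := (div_le_one (by linarith)).2 (by linarith)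
  refine ⟨⟨fun j => ?_, ?_⟩, ⟨by simp only [pathH]; positivity, ?_⟩,
    ⟨by simp only [pathH]; positivity, ?_⟩⟩
  · have := hy.1 j
    have h5 : (pathH γ y s).1 j = (1 - s) * y j + s * (1 / γ.card) := by
      simp only [pathH]; ring
    rw [h5]
    have : 0 ≤ 1 - s := by linarith
    positivity
  · have h5 : ∀ j, (pathH γ y s).1 j = (1 - s) * y j + s * (1 / γ.card) := fun j => by
      simp only [pathH]; ring
    simp only [h5, Finset.sum_add_distrib, ← Finset.mul_sum, Finset.sum_const, Finset.card_univ,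
      Fintype.card_coe, nsmul_eq_mul]
    have h6 : (β.card : ℝ) * (s * (1 / γ.card)) ≤ s := by
      rw [mul_left_comm]
      refine mul_le_of_le_one_right hs0 ?_
      rw [mul_one_div]
      exact (div_le_one (by linarith)).2 hcβ
    have := hy.2
    nlinarith
  · exact mul_le_one₀ hs1 h1 h2
  · exact mul_le_one₀ hs1 h3 h4

theorem pathH_zero {d : ℕ} {β : Finset (Fin d)} (γ : Finset (Fin d)) (y : β → ℝ) :
    pathH γ y 0 = (y, 0, 0) := by
  simp [pathH]

/-- Chain rule within the domain; the velocity of the path is the negative of the direction in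
`dHterm`. -/
theorem hasDerivWithinAt_H_pathH {d : ℕ} {ζ : Measure (Fin d → ℝ)} {β γ : Finset (Fin d)}
    (hβ : β.Nonempty) (hβγ : β ⊆ γ) {y : β → ℝ} (hy : y ∈ openFace β)
    (hdiff : DifferentiableWithinAt ℝ (H ζ β γ) (domH β) (y, 0, 0)) :
    HasDerivWithinAt (fun s => H ζ β γ (pathH γ y s)) (-dHterm ζ β γ y) (Set.Icc 0 1) 0 := by
  have h1 : HasDerivAt (pathH γ y)
      (-((fun j => y j - 1 / (γ.card : ℝ), -(1 / (γ.card : ℝ)), -(1 / ((γ.card : ℝ) + 1))) :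
        (β → ℝ) × ℝ × ℝ)) 0 := by
    have ha : ∀ c e : ℝ, HasDerivAt (fun s : ℝ => c + s * e) e 0 := fun c e => by
      simpa using ((hasDerivAt_id (0 : ℝ)).mul_const e).const_add c
    have hb : ∀ e : ℝ, HasDerivAt (fun s : ℝ => s * e) e 0 := fun e => by
      simpa using (hasDerivAt_id (0 : ℝ)).mul_const e
    have h2 := (hasDerivAt_pi.2 fun j => ha (y j) (1 / γ.card - y j)).prodMk
      ((hb (1 / γ.card)).prodMk (hb (1 / (γ.card + 1))))
    refine (h2.congr_deriv ?_ : HasDerivAt (pathH γ y) _ 0)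
    ext <;> simp
  have h3 : HasFDerivWithinAt (H ζ β γ) (fderivWithin ℝ (H ζ β γ) (domH β) (y, 0, 0)) (domH β)
      (pathH γ y 0) := by
    rw [pathH_zero]; exact hdiff.hasFDerivWithinAt
  have h4 := h3.comp_hasDerivWithinAt 0 h1.hasDerivWithinAt
    (fun s hs => pathH_mem_domH hβ hβγ hy hs)
  rw [map_neg] at h4
  exact h4

theorem real_A_eq {d : ℕ} {α : ℝ} (hα : 0 < α) {S : Measure (Fin d → ℝ)}
    [IsProbabilityMeasure S] (hSs : ∀ᵐ θ ∂S, θ ∈ simplex d) {β : Finset (Fin d)}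
    (hβ : β.Nonempty) {y : β → ℝ} (hyf : y ∈ openFace β)
    (hy : ∀ j : β, ∀ᵐ θ ∂S, θ j ≠ y j)
    (hdiff : ∀ γ : Finset (Fin d), β ⊆ γ →
      DifferentiableWithinAt ℝ (H (projLaw α S) β γ) (domH β) (y, 0, 0)) :
    S.real (A (extend β y)) = (projLaw α S).real (A (extend β y)) +
      α⁻¹ * ∑ γ : Finset (Fin d) with β ⊆ γ, dHterm (projLaw α S) β γ y := by
  have := isProbabilityMeasure_projLaw hα S
  have hd := ne_zero_of_ae_mem_simplex hSs
  have hζ := ae_projLaw_mem hd α S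
  set ζ := projLaw α S with hζdef
  set K : ℝ → ℝ := fun s => ∑ γ : Finset (Fin d) with β ⊆ γ, H ζ β γ (pathH γ y s) with hK
  set D := ∑ γ : Finset (Fin d) with β ⊆ γ, dHterm ζ β γ y with hD
  have hKeq : ∀ s : ℝ, s < 1 → ζ.real {z | proj ((1 - s)⁻¹ • z) ∈ A (extend β y)} = K s :=
    fun s hs => real_proj_smul_mem_A hζ hβ hyf.1 hs
  have hK0 : K 0 = ζ.real (A (extend β y)) := by
    rw [← hKeq 0 one_pos]
    refine measureReal_congr ?_
    filter_upwards [hζ] with z hz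
    refine propext ?_
    change proj ((1 - 0 : ℝ)⁻¹ • z) ∈ _ ↔ _
    rw [sub_zero, inv_one, one_smul, proj_of_mem hz]
    rfl
  have hKd : HasDerivWithinAt K (-D) (Set.Ioi 0) 0 := by
    have h1 : HasDerivWithinAt K (∑ γ : Finset (Fin d) with β ⊆ γ, -dHterm ζ β γ y)
        (Set.Icc 0 1) 0 := by
      have := HasDerivWithinAt.fun_sum (u := Finset.univ.filter fun γ : Finset (Fin d) => β ⊆ γ)
        fun γ hγ => hasDerivWithinAt_H_pathH hβ (Finset.mem_filter.1 hγ).2 hyf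
          (hdiff γ (Finset.mem_filter.1 hγ).2)
      exact this
    rw [Finset.sum_neg_distrib] at h1
    exact h1.mono_of_mem_nhdsWithin (Icc_mem_nhdsGT one_pos)
  have hpd : HasDerivWithinAt (fun s : ℝ => (1 - s) ^ α) (-α) (Set.Ioi 0) 0 := by
    have h1 := ((hasDerivAt_id (0 : ℝ)).const_sub 1).rpow_const (p := α)
      (Or.inl (by simp))
    simpa using h1.hasDerivWithinAt
  have hN : HasDerivWithinAt (fun s => K 0 - (1 - s) ^ α * K s) (α * K 0 + D) (Set.Ioi 0) 0 := by
    have h1 := (hpd.mul hKd).const_sub (K 0)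
    refine h1.congr_deriv ?_
    simp only [sub_zero, Real.one_rpow]
    ring
  have hM : HasDerivWithinAt (fun s : ℝ => 1 - (1 - s) ^ α) α (Set.Ioi 0) 0 := by
    simpa using hpd.const_sub 1
  -- Numerator and denominator both vanish at `s = 0`, so the limit is the quotient of their right
  -- derivatives.
  have hlim : Tendsto (fun s => (K 0 - (1 - s) ^ α * K s) / (1 - (1 - s) ^ α)) (𝓝[>] 0)
      (𝓝 ((α * K 0 + D) / α)) := by
    have h1 := (hasDerivWithinAt_iff_tendsto_slope' (by simp)).1 hN
    have h2 := (hasDerivWithinAt_iff_tendsto_slope' (by simp)).1 hM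
    refine (h1.div h2 hα.ne').congr' ?_
    filter_upwards [self_mem_nhdsWithin] with s hs
    have hs0 : s ≠ 0 := (show (0 : ℝ) < s from hs).ne'
    simp only [Pi.div_apply, slope_def_field, sub_zero, Real.one_rpow, one_mul, sub_self]
    rw [div_div_div_cancel_right₀ hs0]
  have hqlim : Tendsto (fun s : ℝ => (1 - s)⁻¹) (𝓝[>] 0) (𝓝[>] 1) := by
    refine tendsto_nhdsWithin_iff.2 ⟨?_, ?_⟩
    · have : ContinuousAt (fun s : ℝ => (1 - s)⁻¹) 0 :=
        ContinuousAt.inv₀ (by fun_prop) (by simp)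
      simpa using this.tendsto.mono_left nhdsWithin_le_nhds
    · filter_upwards [Ioo_mem_nhdsGT one_pos] with s hs
      have h1 : 0 < 1 - s := by linarith [hs.2]
      exact (one_lt_inv₀ h1).2 (by linarith [hs.1])
  have hlim' := (tendsto_truncated_ratio hα hSs hy).comp hqlim
  have heq : (fun s => (K 0 - (1 - s) ^ α * K s) / (1 - (1 - s) ^ α)) =ᶠ[𝓝[>] 0]
      (fun q : ℝ => ((paretoMeasure 1 α).prod S).real
        {p | p.1 ≤ q ∧ proj (p.1 • p.2) ∈ A (extend β y)} / (1 - q ^ (-α))) ∘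
        fun s : ℝ => (1 - s)⁻¹ := by
    filter_upwards [Ioo_mem_nhdsGT one_pos] with s hs
    have hs1 : 0 < 1 - s := by linarith [hs.2]
    rw [Function.comp_apply, real_le_proj_mem hα S
      ((one_le_inv₀ hs1).2 (by linarith [hs.1])) (measurableSet_A _), ← hζdef,
      hKeq s hs.2, Real.inv_rpow hs1.le, Real.rpow_neg hs1.le, inv_inv, hK0]
  -- The same quotient has been evaluated through the law of `Θ` and through the law of `Z`.
  have h := tendsto_nhds_unique hlim' (hlim.congr' heq)
  rw [h, hK0]
  field_simp

theorem RV.real_A_eq {Ω : Type*} [MeasurableSpace Ω] {d : ℕ} {P : Measure Ω}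
    {X : Ω → Fin d → ℝ} {α : ℝ} {S : Measure (Fin d → ℝ)} (h : RV P X α S)
    (hA : AssumptionA (projLaw α S)) {β : Finset (Fin d)} (hβ : β.Nonempty) :
    ∀ᵐ y ∂(volume.restrict (openFace β)),
      S.real (A (extend β y)) = (projLaw α S).real (A (extend β y)) +
        α⁻¹ * ∑ γ : Finset (Fin d) with β ⊆ γ, dHterm (projLaw α S) β γ y := by
  obtain ⟨hα, hS, hSs, -⟩ := h
  have hface : MeasurableSet (openFace β) :=
    (measurableSet_forall fun j => measurableSet_lt measurable_const (measurable_pi_apply j)).inter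
      (measurableSet_le (Finset.measurable_sum _ fun j _ => measurable_pi_apply j)
        measurable_const)
  have hall : ∀ᵐ y ∂(volume.restrict (openFace β)), ∀ γ : Finset (Fin d), β ⊆ γ →
      ContDiffAtIn (H (projLaw α S) β γ) (domH β) (y, 0, 0) :=
    ae_all_iff.2 fun γ => by
      by_cases hγ : β ⊆ γ
      · filter_upwards [hA β γ hβ hγ] with y hy _ using hy
      · exact ae_of_all _ fun y h => absurd h hγ
  filter_upwards [hall, ae_restrict_mem hface, ae_restrict_of_ae (ae_no_level_mass S β)]
    with y hy hyf hyn
  refine SparseRV.real_A_eq hα hSs hβ hyf hyn fun γ hγ => (hy γ hγ).1.self_of_nhdsWithin ?_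
  rw [← pathH_zero γ y]
  exact pathH_mem_domH hβ hγ hyf (by simp)

end SparseRV

end

/-! ### Assembly of the theorem -/

theorem mainTheorem1 {Ω : Type*} [MeasurableSpace Ω] (P : Measure Ω) [IsProbabilityMeasure P]
    (d : ℕ) (X : Ω → Fin d → ℝ) (hXm : Measurable X) (hX : ∀ ω j, 0 ≤ X ω j) :
    -- equivalence under assumption (A)
    ((∃ (α : ℝ) (S : Measure (Fin d → ℝ)),
        SparseRV.RV P X α S ∧ SparseRV.AssumptionA (SparseRV.projLaw α S)) ↔
      ∃ ν : Measure (ℝ × (Fin d → ℝ)), SparseRV.IsSparselyRV P X ν ∧ SparseRV.AssumptionA ν.snd) ∧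
    -- from regular variation to sparse regular variation
    (∀ (α : ℝ) (S : Measure (Fin d → ℝ)), SparseRV.RV P X α S →
      SparseRV.SRV P X α (SparseRV.projLaw α S) ∧
      ∀ β : Finset (Fin d), β.Nonempty → ∀ x ∈ SparseRV.closedFace β,
        (∀ j ∈ β, x j ≠ 1 / (β.card : ℝ)) →
        SparseRV.G (SparseRV.projLaw α S) β x = ∫ θ, SparseRV.integrandG α β x θ ∂S) ∧
    -- from sparse regular variation to regular variation
    (∀ (α : ℝ) (ζ : Measure (Fin d → ℝ)), SparseRV.SRV P X α ζ → SparseRV.AssumptionA ζ →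
      ∃ S : Measure (Fin d → ℝ), SparseRV.RV P X α S ∧
        ∀ β : Finset (Fin d), β.Nonempty →
          ∀ᵐ y ∂(volume.restrict (SparseRV.openFace β)),
            S.real (SparseRV.A (SparseRV.extend β y)) =
              ζ.real (SparseRV.A (SparseRV.extend β y)) +
                α⁻¹ * ∑ γ : Finset (Fin d) with β ⊆ γ, SparseRV.dHterm ζ β γ y) := by
  have hback : ∀ (α : ℝ) (ζ : Measure (Fin d → ℝ)), SparseRV.SRV P X α ζ →
      ∃ S : Measure (Fin d → ℝ), SparseRV.RV P X α S ∧ ζ = SparseRV.projLaw α S :=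
    fun α ζ h => h.exists_rV hXm hX
  refine ⟨⟨?_, ?_⟩, fun α S h => ⟨h.sRV hXm, fun β hβ x hx hx1 => ?_⟩, fun α ζ h hA => ?_⟩
  · rintro ⟨α, S, h, hA⟩
    obtain ⟨-, ν, hν, -, hsnd⟩ := h.sRV hXm
    exact ⟨ν, hν, by rwa [hsnd]⟩
  · rintro ⟨ν, hν, hA⟩
    have := hν.1
    have : IsProbabilityMeasure (ν.map Prod.fst) :=
      Measure.isProbabilityMeasure_map measurable_fst.aemeasurable
    -- No index is given in this direction; it is read off the radial marginal. Assumption (A) then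
    -- transfers because `ν.snd` is the law of `π(YΘ)`.
    obtain ⟨α, hα, hfst⟩ := SparseRV.CondWeakLimit.exists_pareto hXm
      (hν.2.2.2.comp continuous_fst) hν.2.2.1
    obtain ⟨S, hS, hζ⟩ := hback α ν.snd ⟨hα, ν, hν, hfst, rfl⟩
    exact ⟨α, S, hS, by rwa [← hζ]⟩
  · have := h.2.1
    exact SparseRV.G_projLaw h.1 hβ hx hx1
  · obtain ⟨S, hS, rfl⟩ := hback α ζ h
    exact ⟨S, hS, fun β hβ => hS.real_A_eq hA hβ⟩
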